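/- Let $L$ be a smooth ($C^1$, regular) simple closed contour in $\mathbb C$, positively oriented, with inner domain $D^+$, and let $G\subseteq\mathbb C$ be open with $\overline{D^+}\subset G$. Let $p\ge 2$ be an integer, $0<\alpha\le 1$, let $a,f$ be analytic in $G$ and let $h(t,\tau)$ be analytic in both variables in $G\times G$. Write $h_{0,i}=\partial^i h/\partial\tau^i$. For $r\ge 0$ a function $u$ on $L$ is of class $W^rH_\alpha$ if its derivatives along $L$, $u^{(k)}(t)=\lim_{\tau\to t,\ \tau\in L}\frac{u^{(k-1)}(\tau)-u^{(k-1)}(t)}{\tau-t}$, exist and are continuous and bounded for $k\le r$, and $|u^{(r)}(s)-u^{(r)}(t)|\le M|s-t|^\alpha$ on $L$ for some $M$ (so $W^0H_\alpha=H_\alpha$). For $t\in L$ the hypersingular integral is understood in the Cauchy–Hadamard (finite part) sense: with $L_v=\{\tau\in L:|\tau-t|>v\}$, $$\int_L\frac{u(\tau)\,d\tau}{(\tau-t)^p}=\lim_{v\to0+}\left[\int_{L_v}\frac{u(\tau)\,d\tau}{(\tau-t)^p}-\sum_{k=0}^{p-2}\frac{u^{(k)}(t)}{k!}\int_{L_v}\frac{d\tau}{(\tau-t)^{p-k}}\right],$$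 which for $p=1$ is the Cauchy principal value. Consider the equations $$a(t)x(t)+\frac1{\pi i}\int_L\frac{h(t,\tau)x(\tau)\,d\tau}{(\tau-t)^p}=f(t),\qquad t\in L,\tag{1}$$ $$\frac1{(p-1)!}\sum_{i=0}^{p-1}\binom{p-1}{i}h_{0,i}(t,t)\,x^{(p-1-i)}(t)+a(t)x(t)=f(t).\tag{2}$$ Then: (i) If $x$ is analytic in $D^+$, continuous on $\overline{D^+}$ and of class $H_\alpha$ on $L$, then $\frac1{\pi i}\int_L\frac{h(t,\tau)x(\tau)}{\tau-t}\,d\tau=h(t,t)x(t)$ for every $t\in L$, the principal value existing. (ii) If $x$ is analytic in $D^+$, continuous on $\overline{D^+}$, of class $W^{p-1}H_\alpha$ on $L$, and solves (1) (the integral existing at each $t\in L$), then $x$ solves (2) at every $t\in L$, with derivatives along $L$, and at every point of $D^+$, with complex derivatives. (iii) Conversely, if $x$ is analytic in $G$ and satisfies (2) at every $t\in L$ (in particular if it satisfies (2) throughout $G$), then $x$ solves (1): for every $t\in L$ the integral exists and the equation holds. -/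

import Mathlib

open Set Filter Topology MeasureTheory
open scoped Nat

/-- A smooth simple closed contour in the complex plane: a regular `C¹` parametrization of period
`1` that is injective on a period. -/
structure SmoothClosedContour where
  param : ℝ → ℂ
  contDiff : ContDiff ℝ 1 param
  periodic : Function.Periodic param 1
  deriv_ne_zero : ∀ s, deriv param s ≠ 0
  injOn : InjOn param (Ico 0 1)

namespace SmoothClosedContour

noncomputable section

/-- The contour `L` as a set of points. -/
def carrier (L : SmoothClosedContour) : Set ℂ := range L.param

/-- The inner domain `D⁺`: the points off `L` whose component in the complement of `L` is
bounded. -/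
def inner (L : SmoothClosedContour) : Set ℂ :=
  {z | z ∉ L.carrier ∧ Bornology.IsBounded (connectedComponentIn L.carrierᶜ z)}

/-- The winding number `(1 / 2πi) ∫_L dτ / (τ - z)` of `L` about a point `z` off `L`. -/
def windingNumber (L : SmoothClosedContour) (z : ℂ) : ℂ :=
  (2 * Real.pi * Complex.I)⁻¹ * ∫ s in (0 : ℝ)..1, deriv L.param s / (L.param s - z)

/-- `L` is traversed in the positive sense: once counterclockwise about each inner point. -/
def PositivelyOriented (L : SmoothClosedContour) : Prop :=
  ∀ z ∈ L.inner, L.windingNumber z = 1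

/-- The derivative of order `k` along the contour: iterate the limit of
`(u τ - u t) / (τ - t)` as `τ → t`, `τ ∈ L`. Only the values of `u` on `L` enter. -/
def derivAlong (L : SmoothClosedContour) (k : ℕ) (u : ℂ → ℂ) : ℂ → ℂ :=
  iteratedDerivWithin k u L.carrier

/-- The class `W^r H_α` on `L`: `u` has derivatives up to order `r` along `L`, they are continuous
and bounded, and the `r`-th one satisfies a Hölder condition with exponent `α`. For `r = 0` this
is the class `H_α`. -/
structure IsWH (L : SmoothClosedContour) (r : ℕ) (α : ℝ) (u : ℂ → ℂ) : Prop where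
  differentiableOn : ∀ k < r, DifferentiableOn ℂ (L.derivAlong k u) L.carrier
  continuousOn : ∀ k ≤ r, ContinuousOn (L.derivAlong k u) L.carrier
  bounded : ∃ M : ℝ, ∀ k ≤ r, ∀ t ∈ L.carrier, ‖L.derivAlong k u t‖ ≤ M
  holder : ∃ M : ℝ, ∀ s ∈ L.carrier, ∀ t ∈ L.carrier,
    ‖L.derivAlong r u s - L.derivAlong r u t‖ ≤ M * ‖s - t‖ ^ α

/-- The class of functions in which solutions are sought: analytic in `D⁺`, continuous on the
closure of `D⁺`, with boundary values of class `W^r H_α` on `L`. -/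
structure IsAnalyticWH (L : SmoothClosedContour) (r : ℕ) (α : ℝ) (x : ℂ → ℂ) : Prop where
  analytic : AnalyticOnNhd ℂ x L.inner
  continuousOn : ContinuousOn x (closure L.inner)
  boundary : L.IsWH r α x

/-- The integral `∫ g(τ) dτ` over the part of `L` outside the closed disc of radius `v`
about `t`. -/
def truncatedIntegral (L : SmoothClosedContour) (g : ℂ → ℂ) (t : ℂ) (v : ℝ) : ℂ :=
  ∫ s in {s : ℝ | s ∈ Ioc (0 : ℝ) 1 ∧ v < ‖L.param s - t‖}, g (L.param s) * deriv L.param s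

/-- The divergent part of `∫ u(τ) (τ - t)^{-p} dτ` over the truncated contour: the contribution of
the terms of degree `k < p - 1` of the Taylor expansion of `u` along `L` at `t`. Since `L` is
closed and `(τ - t)^{-(p - k)}`, with `p - k ≥ 2`, has a single-valued primitive, each integral in
it is the difference of the values of `(τ - t)^{-(p - k - 1)} / (p - k - 1)` at the two ends of the
removed arc, of size `v^{-(p - k - 1)}`. -/
def divergentPart (L : SmoothClosedContour) (p : ℕ) (u : ℂ → ℂ) (t : ℂ) (v : ℝ) : ℂ :=
  ∑ k ∈ Finset.range (p - 1), L.derivAlong k u t / (k ! : ℂ) *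
    L.truncatedIntegral (fun τ => 1 / (τ - t) ^ (p - k)) t v

/-- `I` is the value of the integral `∫_L u(τ) / (τ - t)^p dτ` in the sense of Cauchy and Hadamard:
the limit of the integral over the truncated contour after its divergent part has been dropped.
For `p = 1` nothing is dropped and this is the Cauchy principal value. -/
def HasFinitePartIntegral (L : SmoothClosedContour) (p : ℕ) (u : ℂ → ℂ) (t I : ℂ) : Prop :=
  Tendsto (fun v : ℝ => L.truncatedIntegral (fun τ => u τ / (τ - t) ^ p) t v
    - L.divergentPart p u t v) (𝓝[>] 0) (𝓝 I)

/-- `x` solves the hypersingular equation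
`a(t) x(t) + (1 / πi) ∫_L h(t,τ) x(τ) / (τ - t)^p dτ = f(t)` on `L`: at each `t ∈ L` the integral
exists and the equation holds. -/
def SolvesIntegralEq (L : SmoothClosedContour) (p : ℕ) (h : ℂ → ℂ → ℂ) (a f x : ℂ → ℂ) : Prop :=
  ∀ t ∈ L.carrier, ∃ I : ℂ, L.HasFinitePartIntegral p (fun τ => h t τ * x τ) t I ∧
    a t * x t + 1 / (Real.pi * Complex.I) * I = f t

end

end SmoothClosedContour

/-- The differential equation at the point `t`, where `y k` stands for the value at `t` of the
`k`-th derivative of the unknown function: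
`(1 / (p-1)!) ∑_{i<p} C(p-1, i) (∂_τ^i h)(t,t) y_{p-1-i} + a(t) y_0 = f(t)`. -/
def SatisfiesODEAt (p : ℕ) (h : ℂ → ℂ → ℂ) (a f : ℂ → ℂ) (y : ℕ → ℂ) (t : ℂ) : Prop :=
  1 / ((p - 1)! : ℂ) * (∑ i ∈ Finset.range p,
    ((p - 1).choose i : ℂ) * iteratedDeriv i (h t) t * y (p - 1 - i)) + a t * y 0 = f t

/-! Everything rests on one formula: if `u` is analytic in `D⁺`, continuous up to `L` and of class
`W^r H_α` there, the finite part of `∫ u(τ) (τ - t)^{-(r+1)} dτ` equals `πi u^{(r)}(t) / r!`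
(`IsAnalyticWH.hasFinitePartIntegral`). To see this, subtract from `u` its Taylor polynomial of
degree `r` along `L` at `t`. The terms of degree `k < r` are exactly what the finite part discards.
The term of degree `r` leaves the principal value of `∫ dτ / (τ - t)`, which is `πi`. The remainder
`w` is `O(|τ - t|^{r+α})`, so its integral converges absolutely and is the limit of `∫ w(τ) (τ -
z)^{-(r+1)} dτ` as `z` tends to `t` along the outer normal. Those integrals vanish by Cauchy's
theorem, since `w` is analytic in `D⁺` too.

Applied to `h(t, ·) x`, with Leibniz's rule for the derivative of order `p - 1`, the formula turns
(1) into (2) at each point of `L`. This gives (i), (iii) and the part of (ii) on `L`. For `D⁺`, the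
derivatives of `x` extend continuously to `L` by the derivatives along `L`
(`IsAnalyticWH.continuousOn_glue`). Both sides of (2) are then analytic in `D⁺`, continuous on the
closure and equal on the boundary, so the maximum principle makes them equal inside.

Two classical facts are built from the parametrization. The Jordan curve theorem is bypassed by
winding numbers: they are `1` on `D⁺` by orientation and `0` at the other points off `L`, and the
jump `2πi` of the Cauchy integral of `1` across `L` puts the left normal in `D⁺` and the right one
outside (`PositivelyOriented.eventually_normalPoint_mem`). Cauchy's theorem up to the boundary
(`IsHolder.cauchyDefect_eq_zero`) is a Liouville argument: by the Plemelj limits the defect in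
Cauchy's formula is continuous across `L`, by Painlevé's theorem it is entire, and it vanishes at
infinity. -/

namespace SmoothClosedContour

/-! ### Metric geometry of the contour: uniform estimates for chords and normals. -/

variable (L : SmoothClosedContour)

lemma continuous_param : Continuous L.param := L.contDiff.continuous

lemma continuous_deriv_param : Continuous (deriv L.param) := L.contDiff.continuous_deriv le_rfl

lemma hasDerivAt_param (s : ℝ) : HasDerivAt L.param (deriv L.param s) s :=
  (L.contDiff.differentiable one_ne_zero s).hasDerivAt

lemma periodic_deriv_param : Function.Periodic (deriv L.param) 1 := fun s => by
  have h : (fun x => L.param (x + 1)) = L.param := funext L.periodic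
  rw [← deriv_comp_add_const, h]

lemma param_mem_carrier (s : ℝ) : L.param s ∈ L.carrier := mem_range_self s

lemma carrier_eq_image : L.carrier = L.param '' Icc 0 1 := by
  refine Subset.antisymm ?_ (image_subset_range _ _)
  rintro _ ⟨s, rfl⟩
  exact ⟨Int.fract s, ⟨Int.fract_nonneg s, (Int.fract_lt_one s).le⟩, by
    simpa using L.periodic.sub_int_mul_eq (x := s) ⌊s⌋⟩

lemma isCompact_carrier : IsCompact L.carrier := by
  rw [carrier_eq_image]
  exact isCompact_Icc.image L.continuous_param

lemma isClosed_carrier : IsClosed L.carrier := L.isCompact_carrier.isClosed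

lemma isOpen_compl_carrier : IsOpen L.carrierᶜ := L.isClosed_carrier.isOpen_compl

lemma carrier_nonempty : L.carrier.Nonempty := ⟨_, L.param_mem_carrier 0⟩

lemma eq_fract_of_periodic {E : Type*} {f : ℝ → E} (hf : Function.Periodic f 1) (s : ℝ) :
    f s = f (Int.fract s) := by
  simpa using (hf.sub_int_mul_eq (x := s) ⌊s⌋).symm

lemma param_add_ne {s σ : ℝ} (h0 : σ ≠ 0) (h1 : |σ| ≤ 1 / 2) : L.param (s + σ) ≠ L.param s := by
  intro h
  rw [eq_fract_of_periodic L.periodic (s + σ), eq_fract_of_periodic L.periodic s] at h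
  have h2 := L.injOn ⟨Int.fract_nonneg _, Int.fract_lt_one _⟩
    ⟨Int.fract_nonneg _, Int.fract_lt_one _⟩ h
  obtain ⟨n, hn⟩ := Int.fract_eq_fract.1 h2
  rw [add_sub_cancel_left] at hn
  rw [hn] at h0 h1
  have h3 : n ≠ 0 := by rintro rfl; simp at h0
  have h4 : (1 : ℝ) ≤ |(n : ℝ)| := by exact_mod_cast Int.one_le_abs h3
  linarith

lemma exists_deriv_bounds : ∃ m M : ℝ, 0 < m ∧ 0 < M ∧
    ∀ s, m ≤ ‖deriv L.param s‖ ∧ ‖deriv L.param s‖ ≤ M := by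
  have hc : ContinuousOn (fun s => ‖deriv L.param s‖) (Icc 0 1) :=
    L.continuous_deriv_param.norm.continuousOn
  obtain ⟨a, -, ha⟩ := isCompact_Icc.exists_isMinOn (nonempty_Icc.2 zero_le_one) hc
  obtain ⟨b, -, hb⟩ := isCompact_Icc.exists_isMaxOn (nonempty_Icc.2 zero_le_one) hc
  refine ⟨_, _, norm_pos_iff.2 (L.deriv_ne_zero a), norm_pos_iff.2 (L.deriv_ne_zero b), fun s => ?_⟩
  rw [eq_fract_of_periodic L.periodic_deriv_param s]
  have hs : Int.fract s ∈ Icc (0 : ℝ) 1 := ⟨Int.fract_nonneg _, (Int.fract_lt_one _).le⟩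
  exact ⟨ha hs, hb hs⟩

lemma exists_deriv_close {η : ℝ} (hη : 0 < η) : ∃ δ > 0, ∀ s σ : ℝ, |σ| ≤ δ →
    ‖deriv L.param (s + σ) - deriv L.param s‖ ≤ η := by
  -- By periodicity `s` may be taken in `[0, 1]`; the larger interval leaves room for a shift `|σ| ≤
  -- 1`.
  have hu := (isCompact_Icc (a := (-1 : ℝ)) (b := 2)).uniformContinuousOn_of_continuous
    L.continuous_deriv_param.continuousOn
  obtain ⟨δ, hδ, H⟩ := Metric.uniformContinuousOn_iff.1 hu η hη
  refine ⟨min (δ / 2) 1, by positivity, fun s σ hσ => ?_⟩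
  have h1 : |σ| ≤ δ / 2 := hσ.trans (min_le_left _ _)
  have h2 := abs_le.1 (hσ.trans (min_le_right _ _))
  have e1 : deriv L.param (s + σ) = deriv L.param (Int.fract s + σ) := by
    have := L.periodic_deriv_param.sub_int_mul_eq (x := s + σ) ⌊s⌋
    rw [← this, Int.fract]; congr 1; ring
  rw [e1, eq_fract_of_periodic L.periodic_deriv_param s, ← dist_eq_norm]
  have h3 := Int.fract_nonneg s
  have h4 := (Int.fract_lt_one s).le
  refine (H _ ⟨by linarith, by linarith⟩ _ ⟨by linarith, by linarith⟩ ?_).le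
  rw [Real.dist_eq, add_sub_cancel_left]; linarith

/-- Mean value inequality for `x ↦ γ(s + x) - x γ'(s)`, whose derivative is small by uniform
continuity of `γ'`. The point is that `δ` does not depend on `s`. -/
lemma exists_secant_close {η : ℝ} (hη : 0 < η) : ∃ δ > 0, ∀ s σ : ℝ, |σ| ≤ δ →
    ‖L.param (s + σ) - L.param s - σ * deriv L.param s‖ ≤ η * |σ| := by
  obtain ⟨δ, hδ, H⟩ := L.exists_deriv_close hη
  refine ⟨δ, hδ, fun s σ hσ => ?_⟩
  have hd : ∀ x ∈ uIcc 0 σ, HasDerivWithinAt (fun x : ℝ => L.param (s + x) - x * deriv L.param s)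
      (deriv L.param (s + x) - 1 * deriv L.param s) (uIcc 0 σ) x := fun x _ =>
    (((L.hasDerivAt_param (s + x)).comp_const_add s x).sub
      ((Complex.ofRealCLM.hasDerivAt (x := x)).mul_const _)).hasDerivWithinAt
  have := (convex_uIcc 0 σ).norm_image_sub_le_of_norm_hasDerivWithin_le hd (C := η)
    (fun x hx => by
      rw [one_mul]
      refine H s x (le_trans ?_ hσ)
      simpa using abs_sub_left_of_mem_uIcc hx) left_mem_uIcc right_mem_uIcc
  simp only [add_zero, Complex.ofReal_zero, zero_mul, sub_zero, Real.norm_eq_abs] at this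
  refine (le_of_eq ?_).trans this
  congr 1; ring

lemma norm_param_sub_le {M : ℝ} (hM : ∀ s, ‖deriv L.param s‖ ≤ M) (s t : ℝ) :
    ‖L.param s - L.param t‖ ≤ M * |s - t| :=
  convex_univ.norm_image_sub_le_of_norm_hasDerivWithin_le
    (fun x _ => (L.hasDerivAt_param x).hasDerivWithinAt) (fun x _ => hM x) (mem_univ _) (mem_univ _)

/-- For small `σ` the chord is close to `σ γ'(s)` and `|γ'| ≥ m`; for the other `σ` it is bounded
below by compactness, since injectivity keeps it from vanishing. -/
lemma exists_chord_arc : ∃ c > 0, ∀ s σ : ℝ, |σ| ≤ 1 / 2 →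
    c * |σ| ≤ ‖L.param (s + σ) - L.param s‖ := by
  obtain ⟨m, M, hm, -, hmM⟩ := L.exists_deriv_bounds
  obtain ⟨δ, hδ, H⟩ := L.exists_secant_close (half_pos hm)
  have hK : IsCompact (Icc (0 : ℝ) 1 ×ˢ {σ : ℝ | δ ≤ |σ| ∧ |σ| ≤ 1 / 2}) := by
    refine isCompact_Icc.prod (Metric.isCompact_of_isClosed_isBounded ?_ ?_)
    · exact (isClosed_le continuous_const continuous_abs).inter
        (isClosed_le continuous_abs continuous_const)
    · exact (Metric.isBounded_Icc (-1 / 2 : ℝ) (1 / 2)).subset fun σ hσ => by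
        have := abs_le.1 hσ.2
        constructor <;> linarith
  have hc : ContinuousOn (fun q : ℝ × ℝ => ‖L.param (q.1 + q.2) - L.param q.1‖)
      (Icc (0 : ℝ) 1 ×ˢ {σ : ℝ | δ ≤ |σ| ∧ |σ| ≤ 1 / 2}) := by
    have := L.continuous_param
    fun_prop
  obtain ⟨k, hk, hk'⟩ := hK.exists_forall_le' hc (a := 0) (fun q hq => by
    refine norm_pos_iff.2 (sub_ne_zero.2 (L.param_add_ne ?_ hq.2.2))
    exact abs_pos.1 (hδ.trans_le hq.2.1))
  refine ⟨min (m / 2) k, by positivity, fun s σ hσ => ?_⟩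
  rcases le_total |σ| δ with h | h
  · have h1 := H s σ h
    have h2 : ‖(σ : ℂ) * deriv L.param s‖ ≤ ‖L.param (s + σ) - L.param s‖ +
        ‖L.param (s + σ) - L.param s - σ * deriv L.param s‖ := by
      rw [← norm_neg (L.param (s + σ) - L.param s - σ * deriv L.param s)]
      refine le_trans (le_of_eq ?_) (norm_add_le _ _)
      congr 1; ring
    rw [norm_mul, Complex.norm_real, Real.norm_eq_abs] at h2
    have h3 : |σ| * m ≤ |σ| * ‖deriv L.param s‖ := by gcongr; exact (hmM s).1
    have h4 : min (m / 2) k * |σ| ≤ m / 2 * |σ| := by gcongr; exact min_le_left _ _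
    linarith
  · have h1 := hk' (Int.fract s, σ) ⟨⟨Int.fract_nonneg _, (Int.fract_lt_one _).le⟩, h, hσ⟩
    have e1 : L.param (s + σ) = L.param (Int.fract s + σ) := by
      rw [← L.periodic.sub_int_mul_eq (x := s + σ) ⌊s⌋, Int.fract]; congr 1; ring
    rw [e1, eq_fract_of_periodic L.periodic s]
    refine le_trans ?_ h1
    calc min (m / 2) k * |σ| ≤ k * 1 := by
          gcongr
          · exact min_le_right _ _
          · linarith
      _ = k := mul_one k

/-- The point at (signed) distance `ρ |γ'|` from `γ s` along the left normal. -/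
noncomputable def normalPoint (s ρ : ℝ) : ℂ := L.param s + Complex.I * ρ * deriv L.param s

/-- For `|σ| ≤ δ` the difference is `(σ - iρ) γ'(s)` up to an error `m|σ|/4`, and `|σ - iρ| ≥ (|σ| +
|ρ|)/2`. For `|σ| ≥ δ` the chord has length at least `c|σ|`, and `ρ₀` is chosen so that the normal
segment takes away at most `cδ/2`. Both signs of `ρ` are covered, hence both sides of the contour,
and so is `ρ = 0`. -/
lemma exists_nontangential : ∃ c > 0, ∃ ρ₀ > 0, ∀ s σ ρ : ℝ, |σ| ≤ 1 / 2 → |ρ| ≤ ρ₀ →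
    c * (|σ| + |ρ|) ≤ ‖L.param (s + σ) - L.normalPoint s ρ‖ := by
  obtain ⟨m, M, hm, hM, hmM⟩ := L.exists_deriv_bounds
  obtain ⟨c, hc, hca⟩ := L.exists_chord_arc
  obtain ⟨δ, hδ, H⟩ := L.exists_secant_close (show 0 < m / 4 by positivity)
  refine ⟨min (m / 4) (c / 4), by positivity, min δ (c * δ / (2 * M)), by positivity,
    fun s σ ρ hσ hρ => ?_⟩
  rcases le_total |σ| δ with h | h
  · have h1 := H s σ h
    have h2 : ‖((σ : ℂ) - Complex.I * ρ) * deriv L.param s‖ ≤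
        ‖L.param (s + σ) - L.normalPoint s ρ‖ +
        ‖L.param (s + σ) - L.param s - σ * deriv L.param s‖ := by
      rw [← norm_neg (L.param (s + σ) - L.param s - σ * deriv L.param s)]
      refine le_trans (le_of_eq ?_) (norm_add_le _ _)
      congr 1; rw [normalPoint]; ring
    have h3 : (|σ| + |ρ|) / 2 ≤ ‖(σ : ℂ) - Complex.I * ρ‖ := by
      have a1 := Complex.abs_re_le_norm ((σ : ℂ) - Complex.I * ρ)
      have a2 := Complex.abs_im_le_norm ((σ : ℂ) - Complex.I * ρ)
      simp at a1 a2
      linarith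
    rw [norm_mul] at h2
    have h4 : (|σ| + |ρ|) / 2 * m ≤ ‖(σ : ℂ) - Complex.I * ρ‖ * ‖deriv L.param s‖ := by
      gcongr; exact (hmM s).1
    have h5 : min (m / 4) (c / 4) * (|σ| + |ρ|) ≤ m / 4 * (|σ| + |ρ|) := by
      gcongr; exact min_le_left _ _
    nlinarith [abs_nonneg ρ, abs_nonneg σ]
  · have h1 := hca s σ hσ
    have h2 : ‖L.param (s + σ) - L.param s‖ ≤
        ‖L.param (s + σ) - L.normalPoint s ρ‖ + ‖Complex.I * ρ * deriv L.param s‖ := by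
      refine le_trans (le_of_eq ?_) (norm_add_le _ _)
      congr 1; rw [normalPoint]; ring
    have h3 : ‖Complex.I * ρ * deriv L.param s‖ ≤ c * δ / 2 := by
      rw [norm_mul, norm_mul, Complex.norm_I, one_mul, Complex.norm_real, Real.norm_eq_abs]
      calc |ρ| * ‖deriv L.param s‖ ≤ c * δ / (2 * M) * M := by
            gcongr
            · exact hρ.trans (min_le_right _ _)
            · exact (hmM s).2
        _ = c * δ / 2 := by field_simp
    have h5 : min (m / 4) (c / 4) * (|σ| + |ρ|) ≤ c / 4 * (|σ| + |ρ|) := by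
      gcongr; exact min_le_right _ _
    have h6 : |ρ| ≤ δ := hρ.trans (min_le_left _ _)
    nlinarith

/-- The integral of `g` along the contour. -/
noncomputable def contourIntegral (g : ℂ → ℂ) : ℂ :=
  ∫ s in (0 : ℝ)..1, g (L.param s) * deriv L.param s

lemma contourIntegral_eq_shift (g : ℂ → ℂ) (s : ℝ) : L.contourIntegral g =
    ∫ σ in (-(1 / 2) : ℝ)..(1 / 2), g (L.param (s + σ)) * deriv L.param (s + σ) := by
  have hp : Function.Periodic (fun s => g (L.param s) * deriv L.param s) 1 := fun s => by
    simp only [L.periodic s, L.periodic_deriv_param s]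
  have := hp.intervalIntegral_add_eq 0 (s + -(1 / 2))
  rw [intervalIntegral.integral_comp_add_left (fun σ => g (L.param σ) * deriv L.param σ)]
  rw [contourIntegral]
  convert this using 2
  · ring
  · ring

lemma exists_mem_carrier_dist_eq (z : ℂ) : ∃ s : ℝ, ∀ s', ‖z - L.param s‖ ≤ ‖z - L.param s'‖ := by
  obtain ⟨t, ⟨s, rfl⟩, ht⟩ := L.isCompact_carrier.exists_isMinOn L.carrier_nonempty
    (f := fun t => ‖z - t‖) (by fun_prop)
  exact ⟨s, fun s' => ht (L.param_mem_carrier s')⟩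

end SmoothClosedContour

/-! ### Painlevé's theorem: removability of a rectifiable curve. -/

/-- The integral of `F` along the boundary of the rectangle `[a, b] × [c, d]`. -/
noncomputable def rectIntegral (F : ℂ → ℂ) (a b c d : ℝ) : ℂ :=
  (∫ x : ℝ in a..b, F (x + c * Complex.I)) - (∫ x : ℝ in a..b, F (x + d * Complex.I)) +
    Complex.I * (∫ y : ℝ in c..d, F (b + y * Complex.I)) -
    Complex.I * (∫ y : ℝ in c..d, F (a + y * Complex.I))

namespace rectIntegral

variable {F : ℂ → ℂ} (hF : Continuous F)
include hF

lemma intervalIntegrable_horizontal (a b c : ℝ) :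
    IntervalIntegrable (fun x : ℝ => F (x + c * Complex.I)) volume a b :=
  (hF.comp (by fun_prop : Continuous fun x : ℝ => (x : ℂ) + c * Complex.I)).intervalIntegrable _ _

lemma intervalIntegrable_vertical (a c d : ℝ) :
    IntervalIntegrable (fun y : ℝ => F (a + y * Complex.I)) volume c d :=
  (hF.comp (by fun_prop : Continuous fun y : ℝ => (a : ℂ) + y * Complex.I)).intervalIntegrable _ _

lemma add_horizontal (a b e c d : ℝ) :
    rectIntegral F a b c d + rectIntegral F b e c d = rectIntegral F a e c d := by
  have i := intervalIntegrable_horizontal hF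
  simp only [rectIntegral]
  rw [← intervalIntegral.integral_add_adjacent_intervals (i a b c) (i b e c),
    ← intervalIntegral.integral_add_adjacent_intervals (i a b d) (i b e d)]
  ring

lemma add_vertical (a b c d e : ℝ) :
    rectIntegral F a b c d + rectIntegral F a b d e = rectIntegral F a b c e := by
  have i := intervalIntegrable_vertical hF
  simp only [rectIntegral]
  rw [← intervalIntegral.integral_add_adjacent_intervals (i b c d) (i b d e),
    ← intervalIntegral.integral_add_adjacent_intervals (i a c d) (i a d e)]
  ring

lemma sum_grid (x y : ℕ → ℝ) (m n : ℕ) :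
    ∑ i ∈ Finset.range m, ∑ j ∈ Finset.range n, rectIntegral F (x i) (x (i + 1)) (y j) (y (j + 1)) =
      rectIntegral F (x 0) (x m) (y 0) (y n) := by
  have h1 : ∀ a b, ∑ j ∈ Finset.range n, rectIntegral F a b (y j) (y (j + 1)) =
      rectIntegral F a b (y 0) (y n) := fun a b => by
    induction n with
    | zero => simp [rectIntegral]
    | succ n ih => rw [Finset.sum_range_succ, ih, add_vertical hF]
  simp only [h1]
  induction m with
  | zero => simp [rectIntegral]
  | succ n ih => rw [Finset.sum_range_succ, ih, add_horizontal hF]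

lemma sub_const (k : ℂ) (a b c d : ℝ) :
    rectIntegral (fun z => F z - k) a b c d = rectIntegral F a b c d := by
  have i := intervalIntegrable_vertical hF
  have i' := intervalIntegrable_horizontal hF
  simp only [rectIntegral]
  rw [intervalIntegral.integral_sub (i' a b c) intervalIntegrable_const,
    intervalIntegral.integral_sub (i' a b d) intervalIntegrable_const,
    intervalIntegral.integral_sub (i b c d) intervalIntegrable_const,
    intervalIntegral.integral_sub (i a c d) intervalIntegrable_const]
  simp only [intervalIntegral.integral_const]
  ring

lemma norm_le_of_osc {a b c d η : ℝ} (hab : a ≤ b) (hcd : c ≤ d) {k : ℂ}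
    (h : ∀ z : ℂ, z.re ∈ Icc a b → z.im ∈ Icc c d → ‖F z - k‖ ≤ η) :
    ‖rectIntegral F a b c d‖ ≤ 2 * η * ((b - a) + (d - c)) := by
  rw [← sub_const hF k, rectIntegral]
  have H : ∀ y ∈ Icc c d, ‖∫ x : ℝ in a..b, (F (x + y * Complex.I) - k)‖ ≤ η * (b - a) := by
    intro y hy
    refine (intervalIntegral.norm_integral_le_of_norm_le_const (C := η) fun x hx => ?_).trans ?_
    · rw [uIoc_of_le hab] at hx
      exact h _ (by simpa using ⟨hx.1.le, hx.2⟩) (by simpa using hy)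
    · rw [abs_of_nonneg (by linarith)]
  have V : ∀ x ∈ Icc a b, ‖Complex.I * ∫ y : ℝ in c..d, (F (x + y * Complex.I) - k)‖ ≤
      η * (d - c) := by
    intro y hy
    rw [norm_mul, Complex.norm_I, one_mul]
    refine (intervalIntegral.norm_integral_le_of_norm_le_const (C := η) fun x hx => ?_).trans ?_
    · rw [uIoc_of_le hcd] at hx
      exact h _ (by simpa using hy) (by simpa using ⟨hx.1.le, hx.2⟩)
    · rw [abs_of_nonneg (by linarith)]
  refine (norm_sub_le _ _).trans ?_
  have h1 := norm_add_le ((∫ x : ℝ in a..b, (F (x + c * Complex.I) - k)) -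
    (∫ x : ℝ in a..b, (F (x + d * Complex.I) - k)))
    (Complex.I * (∫ y : ℝ in c..d, (F (b + y * Complex.I) - k)))
  have h2 := norm_sub_le (∫ x : ℝ in a..b, (F (x + c * Complex.I) - k))
    (∫ x : ℝ in a..b, (F (x + d * Complex.I) - k))
  have := H c ⟨le_rfl, hcd⟩
  have := H d ⟨hcd, le_rfl⟩
  have := V a ⟨le_rfl, hab⟩
  have := V b ⟨hab, le_rfl⟩
  linarith

end rectIntegral

lemma card_filter_abs_sub_le (n : ℕ) (y D : ℝ) (hD : 0 ≤ D) :
    (((Finset.range n).filter fun i : ℕ => |(i : ℝ) - y| ≤ D).card : ℝ) ≤ 2 * D + 1 := by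
  have h1 : ((Finset.range n).filter fun i : ℕ => |(i : ℝ) - y| ≤ D).card ≤
      (Finset.Icc ⌈y - D⌉ ⌊y + D⌋).card := by
    refine Finset.card_le_card_of_injOn (fun i : ℕ => (i : ℤ)) (fun i hi => ?_)
      (fun i _ j _ h => Int.ofNat_inj.1 h)
    simp only [Finset.coe_filter, mem_ofPred_eq] at hi
    have := abs_le.1 hi.2
    simp only [Finset.coe_Icc, mem_Icc]
    exact ⟨Int.ceil_le.2 (by push_cast; linarith), Int.le_floor.2 (by push_cast; linarith)⟩
  rw [Int.card_Icc] at h1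
  have h2 : (((⌊y + D⌋ + 1 - ⌈y - D⌉).toNat : ℤ) : ℝ) ≤ 2 * D + 1 := by
    have e1 := Int.floor_le (y + D)
    have e2 := Int.le_ceil (y - D)
    rw [Int.toNat_eq_max]
    push_cast
    exact max_le (by linarith) (by linarith)
  have h3 : (((Finset.range n).filter fun i : ℕ => |(i : ℝ) - y| ≤ D).card : ℝ) ≤
    ((⌊y + D⌋ + 1 - ⌈y - D⌉).toNat : ℝ) := by exact_mod_cast h1
  refine h3.trans ?_
  exact_mod_cast h2

/-- The number of cells of an `N × N` grid on a rectangle that meet a rectifiable curve is at most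
a multiple of `N`. -/
lemma card_cells_le {γ : ℝ → ℂ} {K : ℝ} (hK : 0 ≤ K) (hγ : ∀ s t, ‖γ s - γ t‖ ≤ K * |s - t|)
    (a c w l : ℝ) (hw : 0 < w) (hl : 0 < l) (N : ℕ) (hN : 0 < N)
    (T : Finset (ℕ × ℕ)) (hT : T ⊆ Finset.range N ×ˢ Finset.range N)
    (hTγ : ∀ q ∈ T, ∃ s ∈ Icc (0 : ℝ) 1,
      (γ s).re ∈ Icc (a + q.1 * (w / N)) (a + (q.1 + 1) * (w / N)) ∧
      (γ s).im ∈ Icc (c + q.2 * (l / N)) (c + (q.2 + 1) * (l / N))) :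
    (T.card : ℝ) ≤ (2 * (K / w + 1) + 1) * (2 * (K / l + 1) + 1) * (N + 1) := by
  have hN' : (0 : ℝ) < N := by exact_mod_cast hN
  classical
  -- Sample the curve at `k/N`. A cell that meets it at `γ s` is within `K/N` of the sample with `k
  -- = ⌊sN⌋`, so its column and row differ from those of the sample by at most `K/w + 1` and `K/l +
  -- 1`. Each of the `N + 1` samples thus accounts for a bounded number of cells.
  let A : ℕ → Finset ℕ := fun k => (Finset.range N).filter fun i : ℕ =>
    |(i : ℝ) - ((γ (k / N)).re - a) / (w / N)| ≤ K / w + 1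
  let B : ℕ → Finset ℕ := fun k => (Finset.range N).filter fun i : ℕ =>
    |(i : ℝ) - ((γ (k / N)).im - c) / (l / N)| ≤ K / l + 1
  have key : ∀ {x y b w : ℝ} {i : ℕ}, 0 < w → x ∈ Icc (b + i * (w / N)) (b + (i + 1) * (w / N)) →
      |x - y| ≤ K / N → |(i : ℝ) - (y - b) / (w / N)| ≤ K / w + 1 := by
    intro x y b w i hw hx hxy
    have hwN : 0 < w / N := by positivity
    have e1 : (i : ℝ) - (y - b) / (w / N) = (b + i * (w / N) - y) / (w / N) := by
      field_simp; ring
    have e2 : K / w + 1 = (K / N + w / N) / (w / N) := by field_simp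
    rw [e1, e2, abs_div, abs_of_pos hwN]
    gcongr
    rw [abs_le] at hxy ⊢
    obtain ⟨h1, h2⟩ := hx
    constructor <;> linarith
  have hsub : T ⊆ (Finset.range (N + 1)).biUnion fun k => A k ×ˢ B k := by
    intro q hq
    obtain ⟨s, ⟨hs0, hs1⟩, h1, h2⟩ := hTγ q hq
    have hq' := Finset.mem_product.1 (hT hq)
    have hf1 := Nat.floor_le (show 0 ≤ s * N by positivity)
    have hf2 := Nat.lt_floor_add_one (s * N)
    have hd : ‖γ s - γ (⌊s * N⌋₊ / N)‖ ≤ K / N := by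
      refine (hγ _ _).trans ?_
      rw [div_eq_mul_one_div K]
      gcongr
      have e : s - ⌊s * N⌋₊ / N = (s * N - ⌊s * N⌋₊) / N := by field_simp
      rw [e, abs_of_nonneg (div_nonneg (by linarith) hN'.le)]
      gcongr
      linarith
    refine Finset.mem_biUnion.2 ⟨⌊s * N⌋₊, ?_, Finset.mem_product.2 ⟨?_, ?_⟩⟩
    · rw [Finset.mem_range, Nat.lt_succ_iff]
      refine Nat.floor_le_of_le ?_
      nlinarith
    · refine Finset.mem_filter.2 ⟨hq'.1, key hw h1 (le_trans ?_ hd)⟩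
      simpa using Complex.abs_re_le_norm (γ s - γ (⌊s * N⌋₊ / N))
    · refine Finset.mem_filter.2 ⟨hq'.2, key hl h2 (le_trans ?_ hd)⟩
      simpa using Complex.abs_im_le_norm (γ s - γ (⌊s * N⌋₊ / N))
  have hcard : (T.card : ℝ) ≤ ∑ k ∈ Finset.range (N + 1), ((A k).card : ℝ) * (B k).card := by
    have := (Finset.card_le_card hsub).trans Finset.card_biUnion_le
    simp only [Finset.card_product] at this
    exact_mod_cast this
  refine hcard.trans ?_
  calc ∑ k ∈ Finset.range (N + 1), ((A k).card : ℝ) * (B k).card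
      ≤ ∑ k ∈ Finset.range (N + 1), (2 * (K / w + 1) + 1) * (2 * (K / l + 1) + 1) := by
        gcongr with k _
        · exact card_filter_abs_sub_le _ _ _ (by positivity)
        · exact card_filter_abs_sub_le _ _ _ (by positivity)
    _ = _ := by simp; ring

/-- Cut the rectangle into `N²` cells. Those that miss the curve contribute zero by Cauchy's
theorem. The `O(N)` others contribute at most oscillation times perimeter, that is `η · O(1/N)`
each. The sum is `O(η)` with a constant independent of `N`. -/
lemma rectIntegral_eq_zero_of_curve {F : ℂ → ℂ} (hF : Continuous F) {γ : ℝ → ℂ} {K : ℝ}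
    (hK : 0 ≤ K) (hγ : ∀ s t, ‖γ s - γ t‖ ≤ K * |s - t|)
    (hd : ∀ z ∉ γ '' Icc 0 1, DifferentiableAt ℂ F z) {a b c d : ℝ} (hab : a < b) (hcd : c < d) :
    rectIntegral F a b c d = 0 := by
  have hR : IsCompact (Icc a b ×ℂ Icc c d) := isCompact_Icc.reProdIm isCompact_Icc
  have hu := hR.uniformContinuousOn_of_continuous hF.continuousOn
  set w := b - a with hw
  set l := d - c with hl
  have hw0 : 0 < w := sub_pos.2 hab
  have hl0 : 0 < l := sub_pos.2 hcd
  set C := (2 * (K / w + 1) + 1) * (2 * (K / l + 1) + 1) with hC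
  have hC0 : 0 < C := by positivity
  have main : ∀ η > 0, ‖rectIntegral F a b c d‖ ≤ C * 2 * (2 * η * (w + l)) := by
    intro η hη
    obtain ⟨δ, hδ, H⟩ := Metric.uniformContinuousOn_iff.1 hu η hη
    obtain ⟨N, hN⟩ := exists_nat_gt ((w + l) / δ)
    have hN' : (0 : ℝ) < N := lt_of_le_of_lt (by positivity) hN
    have hN0 : 0 < N := by exact_mod_cast hN'
    have hsmall : w / N + l / N < δ := by
      rw [← add_div, div_lt_iff₀ hN']
      rwa [div_lt_iff₀ hδ, mul_comm] at hN
    let x : ℕ → ℝ := fun i => a + i * (w / N)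
    let y : ℕ → ℝ := fun i => c + i * (l / N)
    have hx : ∀ i, x (i + 1) - x i = w / N := fun i => by simp only [x]; push_cast; ring
    have hy : ∀ i, y (i + 1) - y i = l / N := fun i => by simp only [y]; push_cast; ring
    have e := rectIntegral.sum_grid hF x y N N
    have ex0 : x 0 = a := by simp [x]
    have ey0 : y 0 = c := by simp [y]
    have exN : x N = b := by simp only [x]; field_simp; rw [hw]; ring
    have eyN : y N = d := by simp only [y]; field_simp; rw [hl]; ring
    rw [ex0, exN, ey0, eyN, ← Finset.sum_product'] at e
    classical
    -- Selecting the cells with nonzero integral, rather than those meeting the curve, makes the sum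
    -- over `T` the whole integral at once; Cauchy's theorem then shows that they meet the curve.
    set T := (Finset.range N ×ˢ Finset.range N).filter fun q =>
      rectIntegral F (x q.1) (x (q.1 + 1)) (y q.2) (y (q.2 + 1)) ≠ 0 with hTdef
    have hxm : ∀ i, x i ≤ x (i + 1) := fun i => by
      have := hx i; have : 0 < w / N := by positivity
      linarith
    have hym : ∀ i, y i ≤ y (i + 1) := fun i => by
      have := hy i; have : 0 < l / N := by positivity
      linarith
    have hxab : ∀ i < N, a ≤ x i ∧ x (i + 1) ≤ b := fun i hi => by
      have hi' : (i : ℝ) + 1 ≤ N := by exact_mod_cast hi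
      constructor
      · simp only [x]; have : 0 ≤ i * (w / N) := by positivity
        linarith
      · rw [← exN]; simp only [x]; push_cast; gcongr
    have hycd : ∀ i < N, c ≤ y i ∧ y (i + 1) ≤ d := fun i hi => by
      have hi' : (i : ℝ) + 1 ≤ N := by exact_mod_cast hi
      constructor
      · simp only [y]; have : 0 ≤ i * (l / N) := by positivity
        linarith
      · rw [← eyN]; simp only [y]; push_cast; gcongr
    have hTcard : (T.card : ℝ) ≤ C * (N + 1) := by
      refine card_cells_le hK hγ a c w l hw0 hl0 N hN0 T (Finset.filter_subset _ _) fun q hq => ?_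
      have hq2 := (Finset.mem_filter.1 hq).2
      by_contra! hcon
      refine hq2 ?_
      have hdd : DifferentiableOn ℂ F
          (uIcc (x q.1) (x (q.1 + 1)) ×ℂ uIcc (y q.2) (y (q.2 + 1))) := by
        intro z hz
        refine (hd z ?_).differentiableWithinAt
        rintro ⟨s, hs, rfl⟩
        rw [uIcc_of_le (hxm _), uIcc_of_le (hym _)] at hz
        refine hcon s hs ?_ ?_
        · simpa [x] using hz.1
        · simpa [y] using hz.2
      have := Complex.integral_boundary_rect_eq_zero_of_differentiableOn F
        (x q.1 + y q.2 * Complex.I) (x (q.1 + 1) + y (q.2 + 1) * Complex.I) (by simpa using hdd)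
      simpa [rectIntegral] using this
    have hcell : ∀ q ∈ T, ‖rectIntegral F (x q.1) (x (q.1 + 1)) (y q.2) (y (q.2 + 1))‖ ≤
        2 * η * (w / N + l / N) := by
      intro q hq
      have hq' := Finset.mem_product.1 (Finset.mem_filter.1 hq).1
      rw [Finset.mem_range, Finset.mem_range] at hq'
      have h1 := hxab _ hq'.1
      have h2 := hycd _ hq'.2
      rw [← hx q.1, ← hy q.2]
      refine rectIntegral.norm_le_of_osc hF (hxm _) (hym _) (k := F (x q.1 + y q.2 * Complex.I)) ?_
      intro z hz1 hz2
      rw [← dist_eq_norm]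
      refine (H z ⟨⟨h1.1.trans hz1.1, hz1.2.trans h1.2⟩, ⟨h2.1.trans hz2.1, hz2.2.trans h2.2⟩⟩ _
        ⟨?_, ?_⟩ ?_).le
      · simpa using ⟨h1.1, (hxm _).trans h1.2⟩
      · simpa using ⟨h2.1, (hym _).trans h2.2⟩
      · rw [dist_eq_norm]
        refine (Complex.norm_le_abs_re_add_abs_im _).trans_lt (lt_of_le_of_lt ?_ hsmall)
        rw [← hx q.1, ← hy q.2]
        simp only [Complex.sub_re, Complex.add_re, Complex.ofReal_re, Complex.mul_re, Complex.I_re,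
          Complex.ofReal_im, Complex.I_im, Complex.sub_im, Complex.add_im, Complex.mul_im, mul_zero,
          mul_one, sub_zero, add_zero, zero_add]
        rw [abs_of_nonneg (by linarith [hz1.1]), abs_of_nonneg (by linarith [hz2.1])]
        linarith [hz1.2, hz2.2]
    rw [← e, ← Finset.sum_filter_ne_zero]
    calc ‖∑ q ∈ T, rectIntegral F (x q.1) (x (q.1 + 1)) (y q.2) (y (q.2 + 1))‖
        ≤ ∑ q ∈ T, 2 * η * (w / N + l / N) := norm_sum_le_of_le _ hcell
      _ = T.card * (2 * η * (w / N + l / N)) := by simp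
      _ ≤ (C * (N + 1)) * (2 * η * (w / N + l / N)) := by gcongr
      _ = C * ((N + 1) / N) * (2 * η * (w + l)) := by field_simp
      _ ≤ C * 2 * (2 * η * (w + l)) := by
          gcongr
          rw [div_le_iff₀ hN']
          have : (1 : ℝ) ≤ N := by exact_mod_cast hN0
          linarith
  by_contra hne
  have hpos := norm_pos_iff.2 hne
  set E := ‖rectIntegral F a b c d‖ with hE
  have hwl : 0 < w + l := by positivity
  -- This `η` makes the bound equal to `E / 2`, contradicting `E > 0`.
  have := main (E / (8 * C * (w + l))) (by positivity)
  have e : C * 2 * (2 * (E / (8 * C * (w + l))) * (w + l)) = E / 2 := by field_simp; norm_num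
  linarith

/-- **Painlevé's theorem** for a rectifiable curve: a continuous function that is holomorphic off a
Lipschitz curve is entire. -/
theorem differentiable_of_continuous_of_differentiableAt_off_curve {F : ℂ → ℂ} (hF : Continuous F)
    {γ : ℝ → ℂ} {K : ℝ} (hK : 0 ≤ K) (hγ : ∀ s t, ‖γ s - γ t‖ ≤ K * |s - t|)
    (hd : ∀ z ∉ γ '' Icc 0 1, DifferentiableAt ℂ F z) : Differentiable ℂ F := by
  have hz : ∀ a b c d : ℝ, rectIntegral F a b c d = 0 := by
    have h0 : ∀ a b c d : ℝ, a < b → rectIntegral F a b c d = 0 := by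
      intro a b c d hab
      rcases lt_trichotomy c d with h | rfl | h
      · exact rectIntegral_eq_zero_of_curve hF hK hγ hd hab h
      · simp [rectIntegral]
      -- A rectangle traversed with reversed sides cancels the proper one, the two adding up to a
      -- degenerate rectangle.
      · have := rectIntegral.add_vertical hF a b c d c
        rw [rectIntegral_eq_zero_of_curve hF hK hγ hd hab h, add_zero] at this
        rw [this]; simp [rectIntegral]
    intro a b c d
    rcases lt_trichotomy a b with h | rfl | h
    · exact h0 a b c d h
    · simp [rectIntegral]
    · have := rectIntegral.add_horizontal hF a b a c d
      rw [h0 b a c d h, add_zero] at this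
      rw [this]; simp [rectIntegral]
  intro z
  -- Morera: vanishing rectangle integrals give a primitive on a disc, whose derivative `F` is
  -- holomorphic.
  have hcons : Complex.IsConservativeOn F (Metric.ball z 1) := by
    intro u v _
    rw [← add_eq_zero_iff_eq_neg, Complex.wedgeIntegral_add_wedgeIntegral_eq]
    simpa [rectIntegral] using hz u.re v.re u.im v.im
  exact ((hcons.isExactOn_ball hF.continuousOn).differentiableOn Metric.isOpen_ball).differentiableAt
    (Metric.ball_mem_nhds z one_pos)

/-! ### Cauchy type integrals, winding numbers, and the two sides of the contour. -/

namespace SmoothClosedContour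

variable (L : SmoothClosedContour)

lemma exists_shift_eq (s : ℝ) {τ : ℂ} (hτ : τ ∈ L.carrier) : ∃ σ : ℝ, |σ| ≤ 1 / 2 ∧
    τ = L.param (s + σ) := by
  obtain ⟨s', rfl⟩ := hτ
  refine ⟨s' - s - round (s' - s), abs_sub_round _, ?_⟩
  rw [← L.periodic.sub_int_mul_eq (x := s') (round (s' - s))]
  congr 1; ring

lemma param_sub_ne {z : ℂ} (hz : z ∉ L.carrier) (s : ℝ) : L.param s - z ≠ 0 := fun h =>
  hz (sub_eq_zero.1 h ▸ L.param_mem_carrier s)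

lemma continuous_comp_param {u : ℂ → ℂ} (hu : ContinuousOn u L.carrier) :
    Continuous fun s => u (L.param s) :=
  hu.comp_continuous L.continuous_param L.param_mem_carrier

/-- The Cauchy type integral `∫_L u(τ) / (τ - z)^n dτ`. -/
noncomputable def cauchyIntegral (u : ℂ → ℂ) (n : ℕ) (z : ℂ) : ℂ :=
  L.contourIntegral fun τ => u τ / (τ - z) ^ n

lemma continuous_cauchy_integrand {u : ℂ → ℂ} (hu : ContinuousOn u L.carrier) (n : ℕ) {z : ℂ}
    (hz : z ∉ L.carrier) :
    Continuous fun s => u (L.param s) / (L.param s - z) ^ n * deriv L.param s :=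
  ((L.continuous_comp_param hu).div ((L.continuous_param.sub continuous_const).pow n)
    fun s => pow_ne_zero n (L.param_sub_ne hz s)).mul L.continuous_deriv_param

lemma exists_bound {u : ℂ → ℂ} (hu : ContinuousOn u L.carrier) :
    ∃ A > 0, ∀ s, ‖u (L.param s)‖ ≤ A := by
  obtain ⟨A, hA⟩ := L.isCompact_carrier.exists_bound_of_continuousOn hu
  exact ⟨max A 1, by positivity, fun s => (hA _ (L.param_mem_carrier s)).trans (le_max_left _ _)⟩

lemma hasDerivAt_cauchyIntegral {u : ℂ → ℂ} (hu : ContinuousOn u L.carrier) (n : ℕ) {z : ℂ}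
    (hz : z ∉ L.carrier) :
    HasDerivAt (L.cauchyIntegral u n) (n * L.cauchyIntegral u (n + 1) z) z := by
  obtain ⟨m, M, hm, hM, hmM⟩ := L.exists_deriv_bounds
  obtain ⟨A, hA, hAu⟩ := L.exists_bound hu
  obtain ⟨r, hr, hball⟩ := Metric.isOpen_iff.1 L.isOpen_compl_carrier z hz
  -- On the ball of half the radius the kernels are uniformly bounded, which justifies
  -- differentiation under the integral sign.
  have hnear : ∀ x ∈ Metric.ball z (r / 2), ∀ s, r / 2 ≤ ‖L.param s - x‖ := by
    intro x hx s
    by_contra! h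
    refine hball (a := L.param s) ?_ (L.param_mem_carrier s)
    rw [Metric.mem_ball, dist_eq_norm] at hx ⊢
    calc ‖L.param s - z‖ ≤ ‖L.param s - x‖ + ‖x - z‖ := norm_sub_le_norm_sub_add_norm_sub _ _ _
      _ < r := by linarith
  have hoff : ∀ x ∈ Metric.ball z (r / 2), x ∉ L.carrier := by
    rintro x hx ⟨s, rfl⟩
    have := hnear _ hx s
    simp at this
    linarith
  have key := (intervalIntegral.hasDerivAt_integral_of_dominated_loc_of_deriv_le
    (μ := volume) (a := 0) (b := 1) (s := Metric.ball z (r / 2))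
    (F := fun x s => u (L.param s) / (L.param s - x) ^ n * deriv L.param s)
    (F' := fun x s => n * (u (L.param s) / (L.param s - x) ^ (n + 1) * deriv L.param s))
    (bound := fun _ => n * (A / (r / 2) ^ (n + 1) * M)) (x₀ := z)
    (Metric.ball_mem_nhds z (half_pos hr)) ?_ ?_ ?_ ?_ ?_ ?_).2
  · rw [intervalIntegral.integral_const_mul] at key
    exact key
  · filter_upwards [Metric.ball_mem_nhds z (half_pos hr)] with x hx
    exact (L.continuous_cauchy_integrand hu n (hoff x hx)).aestronglyMeasurable
  · exact (L.continuous_cauchy_integrand hu n hz).intervalIntegrable _ _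
  · exact ((L.continuous_cauchy_integrand hu (n + 1) hz).const_mul _).aestronglyMeasurable
  · refine Eventually.of_forall fun s _ x hx => ?_
    have h1 := hnear x hx s
    have h2 := hAu s
    have h3 := (hmM s).2
    rw [norm_mul, norm_mul, norm_div, norm_pow, Complex.norm_natCast]
    gcongr
  · exact intervalIntegrable_const
  · refine Eventually.of_forall fun s _ x hx => ?_
    have hne : L.param s - x ≠ 0 := L.param_sub_ne (hoff x hx) s
    have h1 : HasDerivAt (fun x => L.param s - x) (-1) x := by
      simpa using (hasDerivAt_id x).const_sub (L.param s)
    have h2 := (((h1.fun_pow n).fun_inv (pow_ne_zero n hne)).const_mul (u (L.param s))).mul_const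
      (deriv L.param s)
    simp only [div_eq_mul_inv]
    refine h2.congr_deriv ?_
    rcases n with _ | n
    · simp
    · simp only [Nat.add_sub_cancel]
      field_simp
      ring

lemma tendsto_cauchyIntegral_cocompact {u : ℂ → ℂ} (hu : ContinuousOn u L.carrier) :
    Tendsto (L.cauchyIntegral u 1) (cocompact ℂ) (𝓝 0) := by
  obtain ⟨m, M, hm, hM, hmM⟩ := L.exists_deriv_bounds
  obtain ⟨A, hA, hAu⟩ := L.exists_bound hu
  obtain ⟨R, hR, hRγ⟩ := L.exists_bound continuousOn_id
  have h1 : Tendsto (fun z : ℂ => ‖z‖ - R) (cocompact ℂ) atTop :=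
    tendsto_atTop_add_const_right _ (-R) tendsto_norm_cocompact_atTop
  have h2 : Tendsto (fun z : ℂ => A * M * (‖z‖ - R)⁻¹) (cocompact ℂ) (𝓝 0) := by
    simpa using (tendsto_inv_atTop_zero.comp h1).const_mul (A * M)
  refine squeeze_zero_norm' ?_ h2
  filter_upwards [h1.eventually_gt_atTop 0] with z hz
  have := intervalIntegral.norm_integral_le_of_norm_le_const (a := 0) (b := 1)
    (f := fun s => u (L.param s) / (L.param s - z) ^ 1 * deriv L.param s)
    (C := A * M * (‖z‖ - R)⁻¹) (fun s _ => by
      have h3 := hAu s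
      have h4 := (hmM s).2
      have h5 : ‖z‖ - R ≤ ‖L.param s - z‖ := by
        have := norm_sub_norm_le z (L.param s)
        rw [norm_sub_rev] at this
        have := hRγ s
        simp only [id] at this
        linarith
      rw [norm_mul, norm_div, pow_one]
      calc ‖u (L.param s)‖ / ‖L.param s - z‖ * ‖deriv L.param s‖ ≤ A / (‖z‖ - R) * M := by gcongr
        _ = _ := by rw [div_eq_mul_inv]; ring)
  simpa [cauchyIntegral, contourIntegral] using this

lemma contourIntegral_eq_zero_of_hasDerivAt {g Q : ℂ → ℂ}
    (hg : Continuous fun s => g (L.param s) * deriv L.param s)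
    (hQ : ∀ s, HasDerivAt (fun s => Q (L.param s)) (g (L.param s) * deriv L.param s) s) :
    L.contourIntegral g = 0 := by
  rw [contourIntegral, intervalIntegral.integral_eq_sub_of_hasDerivAt (fun s _ => hQ s)
    (hg.intervalIntegrable _ _)]
  have := L.periodic 0
  rw [zero_add] at this
  rw [this, sub_self]

lemma windingNumber_eq (z : ℂ) :
    L.windingNumber z = (2 * Real.pi * Complex.I)⁻¹ * L.cauchyIntegral 1 1 z := by
  simp [windingNumber, cauchyIntegral, contourIntegral, div_eq_inv_mul]

lemma cauchyIntegral_one_eq (z : ℂ) :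
    L.cauchyIntegral 1 1 z = 2 * Real.pi * Complex.I * L.windingNumber z := by
  rw [windingNumber_eq, mul_inv_cancel_left₀ Complex.two_pi_I_ne_zero]

/-- The integrand has the single-valued primitive `-(τ - z)⁻¹`. As this integral is the derivative
of the Cauchy integral of `1`, the winding number is locally constant. -/
lemma cauchyIntegral_one_two {z : ℂ} (hz : z ∉ L.carrier) : L.cauchyIntegral 1 2 z = 0 := by
  refine L.contourIntegral_eq_zero_of_hasDerivAt (Q := fun τ => -(τ - z)⁻¹)
    (L.continuous_cauchy_integrand continuousOn_const 2 hz) fun s => ?_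
  have := ((((L.hasDerivAt_param s).sub_const z).fun_inv (L.param_sub_ne hz s))).fun_neg
  refine this.congr_deriv ?_
  simp; ring

lemma hasDerivAt_windingNumber {z : ℂ} (hz : z ∉ L.carrier) :
    HasDerivAt L.windingNumber 0 z := by
  have h := (L.hasDerivAt_cauchyIntegral (u := 1) continuousOn_const 1 hz).const_mul
    (2 * Real.pi * Complex.I)⁻¹
  rw [L.cauchyIntegral_one_two hz, mul_zero, mul_zero] at h
  exact h.congr_of_eventuallyEq (Eventually.of_forall fun z => L.windingNumber_eq z)

lemma continuousOn_windingNumber : ContinuousOn L.windingNumber L.carrierᶜ := fun _ hz =>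
  (L.hasDerivAt_windingNumber hz).continuousAt.continuousWithinAt

lemma tendsto_windingNumber_cocompact : Tendsto L.windingNumber (cocompact ℂ) (𝓝 0) := by
  have := (L.tendsto_cauchyIntegral_cocompact (u := 1) continuousOn_const).const_mul
    (2 * Real.pi * Complex.I)⁻¹
  rw [mul_zero] at this
  exact this.congr fun z => (L.windingNumber_eq z).symm

/-- The winding number is constant on the component of `z` and tends to `0` at infinity, so a
nonzero value would force the component to be bounded, that is, `z` to be inner. With positive
orientation, the winding number is therefore the indicator of `D⁺` off `L`. -/
lemma windingNumber_eq_zero_of_not_mem_inner {z : ℂ} (hz : z ∉ L.carrier) (hz' : z ∉ L.inner) :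
    L.windingNumber z = 0 := by
  set U := connectedComponentIn L.carrierᶜ z
  have hU : IsOpen U := L.isOpen_compl_carrier.connectedComponentIn
  have hUL : U ⊆ L.carrierᶜ := connectedComponentIn_subset _ _
  have hconst : ∀ y ∈ U, L.windingNumber y = L.windingNumber z := fun y hy =>
    hU.is_const_of_deriv_eq_zero isPreconnected_connectedComponentIn
      (fun x hx => (L.hasDerivAt_windingNumber (hUL hx)).differentiableAt.differentiableWithinAt)
      (fun x hx => (L.hasDerivAt_windingNumber (hUL hx)).deriv) hy (mem_connectedComponentIn hz)
  by_contra hne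
  refine hz' ⟨hz, ?_⟩
  have hev := L.tendsto_windingNumber_cocompact.eventually_ne (Ne.symm hne)
  rw [← Metric.cobounded_eq_cocompact] at hev
  refine (Bornology.isBounded_compl_iff.2 hev).subset fun y hy => ?_
  simpa using hconst y hy

variable {L}

/-- `D⁺` is the set of points off `L` where the continuous winding number is nonzero. -/
lemma PositivelyOriented.isOpen_inner (hL : L.PositivelyOriented) : IsOpen L.inner := by
  have := L.continuousOn_windingNumber.isOpen_inter_preimage L.isOpen_compl_carrier
    (isOpen_compl_singleton (x := (0 : ℂ)))
  convert this using 1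
  ext z
  refine ⟨fun h => ⟨h.1, ?_⟩, fun h => ?_⟩
  · simp [hL z h]
  · by_contra h'
    exact h.2 (L.windingNumber_eq_zero_of_not_mem_inner h.1 h')

lemma PositivelyOriented.isBounded_inner (hL : L.PositivelyOriented) : Bornology.IsBounded L.inner := by
  have hev := L.tendsto_windingNumber_cocompact.eventually_ne (zero_ne_one' ℂ)
  rw [← Metric.cobounded_eq_cocompact] at hev
  refine (Bornology.isBounded_compl_iff.2 hev).subset fun y hy => ?_
  simpa using hL y hy

variable (L)

/-- The outer domain: the points off the contour and off its inner domain. -/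
def outer : Set ℂ := {z | z ∉ L.carrier ∧ z ∉ L.inner}

variable {L}

lemma PositivelyOriented.isOpen_outer (hL : L.PositivelyOriented) : IsOpen L.outer := by
  have := L.continuousOn_windingNumber.isOpen_inter_preimage L.isOpen_compl_carrier
    (isOpen_compl_singleton (x := (1 : ℂ)))
  convert this using 1
  ext z
  refine ⟨fun h => ⟨h.1, ?_⟩, fun h => ⟨h.1, fun h' => h.2 (hL z h')⟩⟩
  simp [L.windingNumber_eq_zero_of_not_mem_inner h.1 h.2]

/-- A boundary point off `L` would lie in the outer domain, which is open and disjoint from `D⁺`. -/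
lemma PositivelyOriented.frontier_inner_subset (hL : L.PositivelyOriented) : frontier L.inner ⊆ L.carrier := by
  intro z hz
  rw [hL.isOpen_inner.frontier_eq] at hz
  by_contra h
  obtain ⟨y, hy1, hy2⟩ := mem_closure_iff.1 hz.1 L.outer hL.isOpen_outer ⟨h, hz.2⟩
  exact hy1.2 hy2

/-! ### The Cauchy kernel near the contour: blow-up at a point, and the jump. -/

/-- A family of kernels that concentrate at the origin at the scale `ρ`. -/
lemma tendsto_integral_of_scaling {G : ℝ → ℝ → ℂ} {g : ℝ → ℂ} {B : ℝ}
    (hmeas : ∀ ρ, Measurable (G ρ))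
    (hbound : ∀ᶠ ρ in 𝓝[>] (0 : ℝ), ∀ ξ : ℝ, |ρ * ξ| ≤ 1 / 2 → ‖ρ * G ρ (ρ * ξ)‖ ≤ B * (1 + ξ ^ 2)⁻¹)
    (hlim : ∀ᵐ ξ : ℝ, Tendsto (fun ρ : ℝ => ρ * G ρ (ρ * ξ)) (𝓝[>] 0) (𝓝 (g ξ))) :
    Tendsto (fun ρ => ∫ σ in (-(1 / 2) : ℝ)..(1 / 2), G ρ σ) (𝓝[>] 0) (𝓝 (∫ ξ, g ξ)) := by
  let S : Set ℝ := Ioc (-(1 / 2)) (1 / 2)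
  have hB : 0 ≤ B := by
    obtain ⟨ρ, hρ⟩ := hbound.exists
    simpa using (norm_nonneg _).trans (hρ 0 (by simp))
  -- Extend the kernel by zero and substitute `σ = ρ ξ`; the rest is dominated convergence on the
  -- line.
  have hcong : (fun ρ : ℝ => ∫ ξ : ℝ, (ρ : ℂ) * S.indicator (G ρ) (ρ * ξ)) =ᶠ[𝓝[>] 0]
      fun ρ => ∫ σ in (-(1 / 2) : ℝ)..(1 / 2), G ρ σ := by
    filter_upwards [self_mem_nhdsWithin] with ρ hρ
    rw [integral_const_mul, Measure.integral_comp_mul_left (S.indicator (G ρ)),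
      intervalIntegral.integral_of_le (by norm_num), integral_indicator measurableSet_Ioc,
      abs_of_pos (inv_pos.2 hρ), Complex.real_smul, ← mul_assoc]
    have : (ρ : ℂ) ≠ 0 := Complex.ofReal_ne_zero.2 (ne_of_gt hρ)
    simp [this]
  refine Tendsto.congr' hcong ?_
  refine tendsto_integral_filter_of_dominated_convergence (fun ξ => B * (1 + ξ ^ 2)⁻¹) ?_ ?_
    (integrable_inv_one_add_sq.const_mul B) ?_
  · refine Eventually.of_forall fun ρ => Measurable.aestronglyMeasurable ?_
    exact (((hmeas ρ).indicator measurableSet_Ioc).comp (measurable_const_mul ρ)).const_mul _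
  · filter_upwards [hbound] with ρ hρ
    refine Eventually.of_forall fun ξ => ?_
    by_cases h : ρ * ξ ∈ S
    · rw [indicator_of_mem h]
      exact hρ ξ (abs_le.2 ⟨h.1.le, h.2⟩)
    · rw [indicator_of_notMem h]
      simp; positivity
  · filter_upwards [hlim] with ξ hξ
    refine hξ.congr' ?_
    have : Tendsto (fun ρ : ℝ => ρ * ξ) (𝓝[>] 0) (𝓝 0) := by
      have : Tendsto (fun ρ : ℝ => ρ * ξ) (𝓝 0) (𝓝 (0 * ξ)) := by
        exact (continuous_mul_const ξ).tendsto 0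
      rw [zero_mul] at this
      exact this.mono_left nhdsWithin_le_nhds
    filter_upwards [this.eventually (Ioc_mem_nhds (show -(1 / 2 : ℝ) < 0 by norm_num)
      (show (0 : ℝ) < 1 / 2 by norm_num))] with ρ hρ
    rw [indicator_of_mem (show ρ * ξ ∈ S from hρ)]

lemma tendsto_secant (s ξ : ℝ) : Tendsto (fun ρ : ℝ => (L.param (s + ρ * ξ) - L.param s) / ρ)
    (𝓝[>] 0) (𝓝 (ξ * deriv L.param s)) := by
  have h1 : HasDerivAt (fun ρ : ℝ => L.param (s + ρ * ξ)) (ξ • deriv L.param s) 0 := by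
    have h2 : HasDerivAt (fun ρ : ℝ => s + ρ * ξ) ξ 0 := by
      simpa using ((hasDerivAt_id (0 : ℝ)).mul_const ξ).const_add s
    have h3 := L.hasDerivAt_param (s + 0 * ξ)
    have := HasDerivAt.scomp (0 : ℝ) h3 h2
    simpa [Function.comp_def] using this
  have h := h1.tendsto_slope.mono_left (nhdsWithin_mono _ (fun x (hx : 0 < x) => hx.ne'))
  simp only [Complex.real_smul] at h
  refine h.congr fun ρ => ?_
  simp [slope, div_eq_inv_mul]

lemma tendsto_deriv_scaled (s ξ : ℝ) :
    Tendsto (fun ρ : ℝ => deriv L.param (s + ρ * ξ)) (𝓝[>] 0) (𝓝 (deriv L.param s)) := by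
  have hc : Continuous fun ρ : ℝ => deriv L.param (s + ρ * ξ) :=
    L.continuous_deriv_param.comp (by fun_prop)
  have := (hc.tendsto 0).mono_left (nhdsWithin_le_nhds (s := Ioi 0))
  simpa using this

/-- In the blow-up the contour becomes its tangent line and `γ'(s)` cancels. The values `κ = i`,
`-i`, `0` serve the left normal point, the right one, and `γ(s)` itself. -/
lemma tendsto_scaled_kernel (s ξ : ℝ) {κ : ℂ} (hκ : (ξ : ℂ) - κ ≠ 0) :
    Tendsto (fun ρ : ℝ => ρ * (1 / (L.param (s + ρ * ξ) - (L.param s + κ * ρ * deriv L.param s)) *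
      deriv L.param (s + ρ * ξ))) (𝓝[>] 0) (𝓝 (1 / (ξ - κ))) := by
  have hd := L.deriv_ne_zero s
  have h1 := ((tendsto_secant (L := L) s ξ).sub_const (κ * deriv L.param s)).inv₀
    (by rw [← sub_mul]; exact mul_ne_zero hκ hd)
  have h2 := h1.mul (tendsto_deriv_scaled (L := L) s ξ)
  have e : ((ξ : ℂ) * deriv L.param s - κ * deriv L.param s)⁻¹ * deriv L.param s =
      1 / (ξ - κ) := by
    rw [← sub_mul]; field_simp
  rw [e] at h2
  refine h2.congr' ?_
  filter_upwards [self_mem_nhdsWithin] with ρ hρ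
  have hρ' : (ρ : ℂ) ≠ 0 := Complex.ofReal_ne_zero.2 (ne_of_gt hρ)
  rw [← mul_assoc]
  congr 1
  rw [show (L.param (s + ρ * ξ) - L.param s) / ρ - κ * deriv L.param s =
    (L.param (s + ρ * ξ) - (L.param s + κ * ρ * deriv L.param s)) / ρ by field_simp; ring,
    inv_div, mul_one_div]

lemma exists_scaled_lower_bound (s : ℝ) : ∃ c > 0, ∃ ρ₀ > 0, ∀ ρ, 0 < ρ → ρ ≤ ρ₀ → ∀ ξ : ℝ,
    |ρ * ξ| ≤ 1 / 2 →
    c * ρ * (1 + |ξ|) ≤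
      ‖L.param (s + ρ * ξ) - (L.param s + Complex.I * ρ * deriv L.param s)‖ ∧
    c * ρ * (1 + |ξ|) ≤
      ‖L.param (s + ρ * ξ) - (L.param s + -Complex.I * ρ * deriv L.param s)‖ ∧
    c * ρ * |ξ| ≤ ‖L.param (s + ρ * ξ) - L.param s‖ := by
  obtain ⟨c, hc, ρ₀, hρ₀, H⟩ := L.exists_nontangential
  refine ⟨c, hc, ρ₀, hρ₀, fun ρ hρ hρ' ξ hξ => ?_⟩
  have h1 := H s (ρ * ξ) ρ hξ (by rwa [abs_of_pos hρ])
  have h2 := H s (ρ * ξ) (-ρ) hξ (by rwa [abs_neg, abs_of_pos hρ])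
  have h3 := H s (ρ * ξ) 0 hξ (by simpa using hρ₀.le)
  simp only [normalPoint, abs_neg, abs_mul, abs_of_pos hρ, Complex.ofReal_neg, mul_neg, neg_mul,
    Complex.ofReal_zero, mul_zero, zero_mul, add_zero, abs_zero] at h1 h2 h3 ⊢
  refine ⟨?_, ?_, ?_⟩ <;> linarith

lemma inv_one_add_abs_sq_le (ξ : ℝ) : ((1 + |ξ|) ^ 2)⁻¹ ≤ (1 + ξ ^ 2)⁻¹ := by
  gcongr
  nlinarith [abs_nonneg ξ, sq_abs ξ]

lemma measurable_shifted_kernel (s : ℝ) (z : ℂ) :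
    Measurable fun σ : ℝ => 1 / (L.param (s + σ) - z) * deriv L.param (s + σ) := by
  have h1 : Measurable fun σ : ℝ => L.param (s + σ) :=
    (L.continuous_param.comp (continuous_const.add continuous_id)).measurable
  have h2 : Measurable fun σ : ℝ => deriv L.param (s + σ) :=
    (L.continuous_deriv_param.comp (continuous_const.add continuous_id)).measurable
  fun_prop

lemma eventually_normalPoint_notMem (s : ℝ) : ∀ᶠ ρ in 𝓝[>] (0 : ℝ),
    L.normalPoint s ρ ∉ L.carrier ∧ L.normalPoint s (-ρ) ∉ L.carrier := by
  obtain ⟨c, hc, ρ₀, hρ₀, H⟩ := L.exists_nontangential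
  filter_upwards [Ioc_mem_nhdsGT hρ₀] with ρ hρ
  have key : ∀ r : ℝ, |r| = ρ → L.normalPoint s r ∉ L.carrier := fun r hr hmem => by
    obtain ⟨σ, hσ, e⟩ := L.exists_shift_eq s hmem
    have := H s σ r hσ (hr.trans_le hρ.2)
    rw [← e, sub_self, norm_zero, hr] at this
    have h1 : 0 < c * (|σ| + ρ) := mul_pos hc (add_pos_of_nonneg_of_pos (abs_nonneg _) hρ.1)
    linarith
  exact ⟨key ρ (abs_of_pos hρ.1), key (-ρ) (by rw [abs_neg, abs_of_pos hρ.1])⟩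

lemma cauchyIntegral_one_shift (s : ℝ) (z : ℂ) : L.cauchyIntegral 1 1 z =
    ∫ σ in (-(1 / 2) : ℝ)..(1 / 2), 1 / (L.param (s + σ) - z) * deriv L.param (s + σ) := by
  rw [cauchyIntegral, L.contourIntegral_eq_shift _ s]
  simp

lemma intervalIntegrable_shifted_kernel (s : ℝ) {z : ℂ} (hz : z ∉ L.carrier) (a b : ℝ) :
    IntervalIntegrable (fun σ : ℝ => 1 / (L.param (s + σ) - z) * deriv L.param (s + σ))
      volume a b := by
  have := (L.continuous_cauchy_integrand (u := 1) continuousOn_const 1 hz).comp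
    (continuous_const_add s)
  refine Continuous.intervalIntegrable ?_ _ _
  simpa [Function.comp_def] using this

lemma normalPoint_neg (s ρ : ℝ) :
    L.normalPoint s (-ρ) = L.param s + -Complex.I * ρ * deriv L.param s := by
  simp [normalPoint]

lemma ofReal_sub_I_ne_zero (ξ : ℝ) : (ξ : ℂ) - Complex.I ≠ 0 := fun h => by
  simpa using congrArg Complex.im h

lemma ofReal_add_I_ne_zero (ξ : ℝ) : (ξ : ℂ) + Complex.I ≠ 0 := fun h => by
  simpa using congrArg Complex.im h

/-- The jump of `∫_L dτ / (τ - z)` across the contour. -/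
lemma tendsto_jump (s : ℝ) : Tendsto
    (fun ρ => L.cauchyIntegral 1 1 (L.normalPoint s ρ) - L.cauchyIntegral 1 1 (L.normalPoint s (-ρ)))
    (𝓝[>] 0) (𝓝 (2 * Real.pi * Complex.I)) := by
  obtain ⟨c, hc, ρ₀, hρ₀, H⟩ := exists_scaled_lower_bound (L := L) s
  obtain ⟨m, M, hm, hM, hmM⟩ := L.exists_deriv_bounds
  -- The blown-up difference of kernels is `2i / (1 + ξ²)`, whose integral is `2πi`.
  have hint : ∫ ξ : ℝ, (1 / ((ξ : ℂ) - Complex.I) - 1 / (ξ - -Complex.I)) =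
      2 * Real.pi * Complex.I := by
    have e : ∀ ξ : ℝ, 1 / ((ξ : ℂ) - Complex.I) - 1 / (ξ - -Complex.I) =
        2 * Complex.I * (((1 + ξ ^ 2)⁻¹ : ℝ) : ℂ) := fun ξ => by
      have h1 := ofReal_sub_I_ne_zero ξ
      have h2 := ofReal_add_I_ne_zero ξ
      have h3 : (1 + (ξ : ℂ) ^ 2) = (ξ - Complex.I) * (ξ + Complex.I) := by
        ring_nf; rw [Complex.I_sq]; ring
      push_cast
      rw [h3, sub_neg_eq_add]
      field_simp
      ring
    simp_rw [e]
    rw [integral_const_mul, integral_complex_ofReal, integral_univ_inv_one_add_sq]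
    ring
  rw [← hint]
  refine (tendsto_integral_of_scaling (B := 2 * M ^ 2 / c ^ 2)
    (G := fun ρ σ => 1 / (L.param (s + σ) - (L.param s + Complex.I * ρ * deriv L.param s)) *
        deriv L.param (s + σ) -
      1 / (L.param (s + σ) - (L.param s + -Complex.I * ρ * deriv L.param s)) *
        deriv L.param (s + σ)) ?_ ?_ ?_).congr' ?_
  · exact fun ρ => (measurable_shifted_kernel s _).sub (measurable_shifted_kernel s _)
  · filter_upwards [Ioc_mem_nhdsGT hρ₀] with ρ hρ ξ hξ
    obtain ⟨h1, h2, -⟩ := H ρ hρ.1 hρ.2 ξ hξ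
    have hρ0 := hρ.1
    have hd := (hmM s).2
    have hd' := (hmM (s + ρ * ξ)).2
    set a := L.param (s + ρ * ξ) - (L.param s + Complex.I * ρ * deriv L.param s) with ha
    set b := L.param (s + ρ * ξ) - (L.param s + -Complex.I * ρ * deriv L.param s) with hb
    have hp : 0 < c * ρ * (1 + |ξ|) := by positivity
    have ha0 : a ≠ 0 := norm_pos_iff.1 (hp.trans_le h1)
    have hb0 : b ≠ 0 := norm_pos_iff.1 (hp.trans_le h2)
    -- Each kernel alone decays only like `1/|ξ|`; the difference has both denominators, hence the
    -- integrable decay `(1 + |ξ|)⁻²`.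
    have e : (ρ : ℂ) * (1 / a * deriv L.param (s + ρ * ξ) - 1 / b * deriv L.param (s + ρ * ξ)) =
        ρ * deriv L.param (s + ρ * ξ) * (2 * Complex.I * ρ * deriv L.param s) / (a * b) := by
      have : 2 * Complex.I * ρ * deriv L.param s = b - a := by rw [ha, hb]; ring
      rw [this]; field_simp
    rw [e, norm_div, norm_mul, norm_mul, norm_mul, norm_mul, norm_mul, norm_mul, Complex.norm_I,
      Complex.norm_real, Real.norm_eq_abs, abs_of_pos hρ0, Complex.norm_two]
    calc ρ * ‖deriv L.param (s + ρ * ξ)‖ * (2 * 1 * ρ * ‖deriv L.param s‖) / (‖a‖ * ‖b‖)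
        ≤ ρ * M * (2 * 1 * ρ * M) / ((c * ρ * (1 + |ξ|)) * (c * ρ * (1 + |ξ|))) := by gcongr
      _ = 2 * M ^ 2 / c ^ 2 * ((1 + |ξ|) ^ 2)⁻¹ := by field_simp
      _ ≤ _ := mul_le_mul_of_nonneg_left (inv_one_add_abs_sq_le ξ) (by positivity)
  · refine Eventually.of_forall fun ξ => ?_
    have h1 := (tendsto_scaled_kernel (L := L) s ξ (ofReal_sub_I_ne_zero ξ)).sub
      (tendsto_scaled_kernel (L := L) s ξ (κ := -Complex.I)
        (by rw [sub_neg_eq_add]; exact ofReal_add_I_ne_zero ξ))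
    exact h1.congr fun ρ => (mul_sub _ _ _).symm
  · filter_upwards [eventually_normalPoint_notMem (L := L) s] with ρ hρ
    rw [cauchyIntegral_one_shift s, cauchyIntegral_one_shift s, ← intervalIntegral.integral_sub
      (intervalIntegrable_shifted_kernel s hρ.1 _ _) (intervalIntegrable_shifted_kernel s hρ.2 _ _),
      normalPoint_neg, normalPoint]

/-- The winding numbers at the two points are `0` or `1` and their difference tends to `1`. Once it
is neither `0` nor `-1`, the left point is inner and the right one outer. -/
lemma PositivelyOriented.eventually_normalPoint_mem (hL : L.PositivelyOriented) (s : ℝ) :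
    ∀ᶠ ρ in 𝓝[>] (0 : ℝ), L.normalPoint s ρ ∈ L.inner ∧ L.normalPoint s (-ρ) ∈ L.outer := by
  have h1 := (tendsto_jump (L := L) s).const_mul (2 * Real.pi * Complex.I)⁻¹
  rw [inv_mul_cancel₀ Complex.two_pi_I_ne_zero] at h1
  have h2 := h1.eventually_ne (show (1 : ℂ) ≠ 0 by norm_num)
  have h3 := h1.eventually_ne (show (1 : ℂ) ≠ -1 by norm_num)
  filter_upwards [h2, h3, eventually_normalPoint_notMem (L := L) s] with ρ h2 h3 ⟨h4, h5⟩
  rw [mul_sub, ← windingNumber_eq, ← windingNumber_eq] at h2 h3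
  by_cases i1 : L.normalPoint s ρ ∈ L.inner <;> by_cases i2 : L.normalPoint s (-ρ) ∈ L.inner
  · rw [hL _ i1, hL _ i2] at h2; simp at h2
  · exact ⟨i1, h5, i2⟩
  · rw [L.windingNumber_eq_zero_of_not_mem_inner h4 i1, hL _ i2] at h3; simp at h3
  · rw [L.windingNumber_eq_zero_of_not_mem_inner h4 i1,
      L.windingNumber_eq_zero_of_not_mem_inner h5 i2] at h2
    simp at h2

lemma continuous_normalPoint (s : ℝ) : Continuous (L.normalPoint s) := by
  unfold normalPoint; fun_prop

lemma tendsto_normalPoint (s : ℝ) :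
    Tendsto (L.normalPoint s) (𝓝[>] 0) (𝓝 (L.param s)) := by
  have := (continuous_normalPoint (L := L) s).tendsto 0
  simp only [normalPoint, Complex.ofReal_zero, mul_zero, zero_mul, add_zero] at this
  exact this.mono_left nhdsWithin_le_nhds

lemma tendsto_normalPoint_neg (s : ℝ) :
    Tendsto (fun ρ => L.normalPoint s (-ρ)) (𝓝[>] 0) (𝓝 (L.param s)) := by
  have := ((continuous_normalPoint (L := L) s).comp continuous_neg).tendsto 0
  simp only [Function.comp_def, neg_zero, normalPoint, Complex.ofReal_zero, mul_zero, zero_mul,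
    add_zero] at this
  exact this.mono_left nhdsWithin_le_nhds

lemma PositivelyOriented.carrier_subset_closure_inner (hL : L.PositivelyOriented) :
    L.carrier ⊆ closure L.inner := by
  rintro _ ⟨s, rfl⟩
  exact mem_closure_of_tendsto (tendsto_normalPoint s)
    ((hL.eventually_normalPoint_mem s).mono fun _ h => h.1)

lemma PositivelyOriented.carrier_subset_closure_outer (hL : L.PositivelyOriented) :
    L.carrier ⊆ closure L.outer := by
  rintro _ ⟨s, rfl⟩
  exact mem_closure_of_tendsto (tendsto_normalPoint_neg s)
    ((hL.eventually_normalPoint_mem s).mono fun _ h => h.2)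

/-! ### The principal value of the Cauchy kernel. -/

lemma truncatedIntegral_eq (g : ℂ → ℂ) (t : ℂ) (v : ℝ) : L.truncatedIntegral g t v =
    L.contourIntegral fun τ => if v < ‖τ - t‖ then g τ else 0 := by
  have hm : MeasurableSet {s : ℝ | v < ‖L.param s - t‖} :=
    (isOpen_lt continuous_const (L.continuous_param.sub continuous_const).norm).measurableSet
  have e : {s : ℝ | s ∈ Ioc (0 : ℝ) 1 ∧ v < ‖L.param s - t‖} =
    Ioc 0 1 ∩ {s : ℝ | v < ‖L.param s - t‖} := rfl
  rw [truncatedIntegral, e, ← setIntegral_indicator hm, contourIntegral,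
    intervalIntegral.integral_of_le zero_le_one]
  refine setIntegral_congr_fun measurableSet_Ioc fun s _ => ?_
  by_cases h : v < ‖L.param s - t‖ <;> simp [indicator, h]

lemma intervalIntegrable_truncated {u : ℂ → ℂ} (hu : ContinuousOn u L.carrier) (k : ℕ) (t : ℂ)
    {v : ℝ} (hv : 0 < v) (a b : ℝ) :
    IntervalIntegrable (fun s => (if v < ‖L.param s - t‖ then u (L.param s) / (L.param s - t) ^ k
      else 0) * deriv L.param s) volume a b := by
  obtain ⟨m, M, hm, hM, hmM⟩ := L.exists_deriv_bounds
  obtain ⟨A, hA, hAu⟩ := L.exists_bound hu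
  have h1 := (L.continuous_comp_param hu).measurable
  have h2 := L.continuous_param.measurable
  have h3 := L.continuous_deriv_param.measurable
  have hms : MeasurableSet {s : ℝ | v < ‖L.param s - t‖} :=
    (isOpen_lt continuous_const (L.continuous_param.sub continuous_const).norm).measurableSet
  refine (intervalIntegrable_const (c := A / v ^ k * M)).mono_fun' ?_ ?_
  · exact ((Measurable.ite hms (h1.div ((h2.sub_const t).pow_const k))
      measurable_const).mul h3).aestronglyMeasurable
  · refine Eventually.of_forall fun s => ?_
    have h4 := hAu s
    have h5 := (hmM s).2
    by_cases h : v < ‖L.param s - t‖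
    · simp only [h, if_true, norm_mul, norm_div, norm_pow]
      gcongr
    · simp only [h, if_false, zero_mul, norm_zero]
      positivity

lemma integral_eq_zero_of_odd {g : ℝ → ℂ} (hg : ∀ x, g (-x) = -g x) : ∫ x, g x = 0 := by
  have h := integral_neg_eq_self g volume
  simp only [hg, integral_neg] at h
  exact self_eq_neg.1 h.symm

/-- This is the blow-up limit of the averaged kernel less the truncated one; it is odd. -/
lemma integral_average_kernel_eq_zero : ∫ ξ : ℝ, (1 / 2 * (1 / ((ξ : ℂ) - Complex.I) +
    1 / (ξ - -Complex.I)) - if 1 < |ξ| then 1 / ((ξ : ℂ) - 0) else 0) = 0 := by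
  refine integral_eq_zero_of_odd fun ξ => ?_
  have e : 1 / 2 * (1 / (-(ξ : ℂ) - Complex.I) + 1 / (-ξ + Complex.I)) =
      -(1 / 2 * (1 / ((ξ : ℂ) - Complex.I) + 1 / (ξ + Complex.I))) := by
    rw [show -(ξ : ℂ) - Complex.I = -(ξ + Complex.I) by ring,
      show -(ξ : ℂ) + Complex.I = -(ξ - Complex.I) by ring, div_neg, div_neg]
    ring
  simp only [abs_neg, Complex.ofReal_neg, sub_neg_eq_add, sub_zero]
  rw [e]
  split_ifs <;> simp [div_neg]; ring

/-- Outside the removed disc, `(1/a + 1/b)/2 - 1/d = -(ρw)²/(abd)` because `a + b = 2d` and `ab = d²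
+ (ρw)²`; with `|d|` at least a multiple of `ρ` this decays like `(1 + |ξ|)⁻²`. Inside the disc `|ξ|
≤ M/c`, so a constant bound suffices. The two constants in the maximum belong to these cases. -/
lemma norm_average_kernel_le {a b d w g : ℂ} {c m M ρ ξ : ℝ} (hc : 0 < c) (hm : 0 < m) (hM : 0 < M)
    (hρ0 : 0 < ρ) (hdM : ‖w‖ ≤ M) (hdm : m ≤ ‖w‖) (hd' : ‖g‖ ≤ M)
    (ha : a = d - Complex.I * (ρ * w)) (hb : b = d + Complex.I * (ρ * w))
    (h1 : c * ρ * (1 + |ξ|) ≤ ‖a‖) (h2 : c * ρ * (1 + |ξ|) ≤ ‖b‖) (h3 : c * ρ * |ξ| ≤ ‖d‖) :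
    ‖(ρ : ℂ) * (1 / 2 * (1 / a * g + 1 / b * g) - if ρ * ‖w‖ < ‖d‖ then 1 / d * g else 0)‖ ≤
      max (M ^ 3 / (min c (m / 2) * c ^ 2)) (M / c * (1 + (M / c) ^ 2)) * (1 + ξ ^ 2)⁻¹ := by
  have hp : 0 < c * ρ * (1 + |ξ|) := by positivity
  have hρn : ‖(ρ : ℂ)‖ = ρ := by rw [Complex.norm_real, Real.norm_eq_abs, abs_of_pos hρ0]
  have ha0 : a ≠ 0 := norm_pos_iff.1 (hp.trans_le h1)
  have hb0 : b ≠ 0 := norm_pos_iff.1 (hp.trans_le h2)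
  have hξ0 : (0 : ℝ) < 1 + |ξ| := by positivity
  split_ifs with hcase
  · have hd0 : d ≠ 0 := norm_pos_iff.1 (lt_of_le_of_lt (by positivity) hcase)
    have h4 : min c (m / 2) * ρ * 1 ≤ ‖d‖ := by
      have : min c (m / 2) * ρ * 1 ≤ m / 2 * ρ * 1 := by gcongr; exact min_le_right _ _
      have : ρ * m ≤ ρ * ‖w‖ := by gcongr
      nlinarith
    have hk : 0 < min c (m / 2) := by positivity
    have e : (ρ : ℂ) * (1 / 2 * (1 / a * g +
        1 / b * g) - 1 / d * g) =
        -(ρ * g * (ρ * w) ^ 2 / (a * b * d)) := by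
      have e3 : (ρ * w) ^ 2 = a * b - d ^ 2 := by
        rw [ha, hb]; ring_nf; rw [Complex.I_sq]; ring
      have e4 : a + b = 2 * d := by rw [ha, hb]; ring
      rw [e3]
      field_simp
      linear_combination ρ * g * d * e4
    rw [e, norm_neg, norm_div, norm_mul, norm_mul, norm_pow, norm_mul, norm_mul, norm_mul, hρn]
    calc ρ * ‖g‖ * (ρ * ‖w‖) ^ 2 / (‖a‖ * ‖b‖ * ‖d‖)
        ≤ ρ * M * (ρ * M) ^ 2 /
          ((c * ρ * (1 + |ξ|)) * (c * ρ * (1 + |ξ|)) * (min c (m / 2) * ρ * 1)) := by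
            gcongr
      _ = M ^ 3 / (min c (m / 2) * c ^ 2) * ((1 + |ξ|) ^ 2)⁻¹ := by field_simp
      _ ≤ M ^ 3 / (min c (m / 2) * c ^ 2) * (1 + ξ ^ 2)⁻¹ :=
          mul_le_mul_of_nonneg_left (inv_one_add_abs_sq_le ξ) (by positivity)
      _ ≤ _ := by gcongr; exact le_max_left _ _
  · have hX : |ξ| ≤ M / c := by
      rw [le_div_iff₀ hc]
      have : ρ * ‖w‖ ≤ ρ * M := by gcongr
      have : ρ * (|ξ| * c) ≤ ρ * M := by linarith [not_lt.1 hcase]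
      exact le_of_mul_le_mul_left this hρ0
    have h5 : c * ρ ≤ c * ρ * (1 + |ξ|) := by
      have : 0 ≤ c * ρ * |ξ| := by positivity
      linarith
    have h6 : ‖(ρ : ℂ) * (1 / 2 * (1 / a * g +
        1 / b * g) - 0)‖ ≤ M / c := by
      rw [sub_zero, norm_mul, norm_mul, hρn]
      have h7 := h5.trans h1
      have h8 := h5.trans h2
      calc ρ * (‖(1 / 2 : ℂ)‖ * ‖1 / a * g +
            1 / b * g‖)
          ≤ ρ * (1 / 2 * (1 / (c * ρ) * M + 1 / (c * ρ) * M)) := by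
            gcongr
            · simp
            · refine (norm_add_le _ _).trans ?_
              rw [norm_mul, norm_mul, norm_div, norm_div, norm_one]
              gcongr
        _ = M / c := by field_simp; norm_num
    refine h6.trans ?_
    have h9 : ξ ^ 2 ≤ (M / c) ^ 2 := by rw [← sq_abs ξ]; gcongr
    calc M / c = M / c * (1 + ξ ^ 2) * (1 + ξ ^ 2)⁻¹ := by
          rw [mul_inv_cancel_right₀ (by positivity)]
      _ ≤ M / c * (1 + (M / c) ^ 2) * (1 + ξ ^ 2)⁻¹ := by gcongr
      _ ≤ _ := by gcongr; exact le_max_right _ _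

variable (L) in
/-- The average of the kernels of the Cauchy integrals at the two points at distance `ρ |γ'|` from
`γ s` on the normal, less the truncated kernel at `γ s`. -/
noncomputable def averageKernel (s ρ σ : ℝ) : ℂ :=
  1 / 2 * (1 / (L.param (s + σ) - (L.param s + Complex.I * ρ * deriv L.param s)) *
      deriv L.param (s + σ) +
    1 / (L.param (s + σ) - (L.param s + -Complex.I * ρ * deriv L.param s)) *
      deriv L.param (s + σ)) -
    if ρ * ‖deriv L.param s‖ < ‖L.param (s + σ) - L.param s‖ then
      1 / (L.param (s + σ) - L.param s) * deriv L.param (s + σ) else 0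

/-- Consequently the truncated integral over `|τ - t| > ρ|γ'(s)|` has the same limit as the average
of the Cauchy integrals at the two normal points. -/
lemma tendsto_integral_averageKernel (s : ℝ) : Tendsto (fun ρ : ℝ =>
    ∫ σ in (-(1 / 2) : ℝ)..(1 / 2), L.averageKernel s ρ σ) (𝓝[>] 0) (𝓝 0) := by
  obtain ⟨c, hc, ρ₀, hρ₀, H⟩ := exists_scaled_lower_bound (L := L) s
  obtain ⟨m, M, hm, hM, hmM⟩ := L.exists_deriv_bounds
  let g : ℝ → ℂ := fun ξ => 1 / 2 * (1 / ((ξ : ℂ) - Complex.I) + 1 / (ξ - -Complex.I)) -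
    if 1 < |ξ| then 1 / ((ξ : ℂ) - 0) else 0
  have hint : ∫ ξ, g ξ = 0 := integral_average_kernel_eq_zero
  rw [← hint]
  refine tendsto_integral_of_scaling
    (B := max (M ^ 3 / (min c (m / 2) * c ^ 2)) (M / c * (1 + (M / c) ^ 2)))
    (G := L.averageKernel s) ?_ ?_ ?_
  · intro ρ
    refine (((measurable_shifted_kernel s _).add (measurable_shifted_kernel s _)).const_mul _).sub
      (Measurable.ite ?_ (measurable_shifted_kernel s _) measurable_const)
    refine (isOpen_lt continuous_const ?_).measurableSet
    exact ((L.continuous_param.comp (continuous_const_add s)).sub continuous_const).norm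
  · filter_upwards [Ioc_mem_nhdsGT hρ₀] with ρ hρ ξ hξ
    obtain ⟨h1, h2, h3⟩ := H ρ hρ.1 hρ.2 ξ hξ
    exact norm_average_kernel_le hc hm hM hρ.1 (hmM s).2 (hmM s).1 (hmM (s + ρ * ξ)).2
      (a := L.param (s + ρ * ξ) - (L.param s + Complex.I * ρ * deriv L.param s))
      (b := L.param (s + ρ * ξ) - (L.param s + -Complex.I * ρ * deriv L.param s))
      (d := L.param (s + ρ * ξ) - L.param s) (by ring) (by ring) h1 h2 h3
  -- At `ξ = ±1` the limit does not decide on which side of the truncation the point falls.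
  · have hae : ∀ᵐ ξ : ℝ, ξ ∉ ({1, -1} : Set ℝ) :=
      measure_eq_zero_iff_ae_notMem.1 ((Set.toFinite _).measure_zero _)
    filter_upwards [hae] with ξ hξ
    have hξ1 : |ξ| ≠ 1 := fun h => hξ (by
      rcases eq_or_eq_neg_of_abs_eq h with h | h <;> simp [h])
    have h1 := ((tendsto_scaled_kernel (L := L) s ξ (ofReal_sub_I_ne_zero ξ)).add
      (tendsto_scaled_kernel (L := L) s ξ (κ := -Complex.I)
        (by rw [sub_neg_eq_add]; exact ofReal_add_I_ne_zero ξ))).const_mul (1 / 2)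
    have h2 := (tendsto_secant (L := L) s ξ).norm
    rw [norm_mul, Complex.norm_real, Real.norm_eq_abs] at h2
    have hdpos : 0 < ‖deriv L.param s‖ := norm_pos_iff.2 (L.deriv_ne_zero s)
    have hnorm : ∀ ρ : ℝ, 0 < ρ → (ρ * ‖deriv L.param s‖ < ‖L.param (s + ρ * ξ) - L.param s‖ ↔
        ‖deriv L.param s‖ < ‖(L.param (s + ρ * ξ) - L.param s) / ρ‖) := fun ρ hρ => by
      rw [norm_div, Complex.norm_real, Real.norm_eq_abs, abs_of_pos hρ, lt_div_iff₀ hρ, mul_comm]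
    rcases lt_or_gt_of_ne hξ1 with hlt | hgt
    · have h3 : |ξ| * ‖deriv L.param s‖ < ‖deriv L.param s‖ := by nlinarith
      have eg : g ξ = 1 / 2 * (1 / ((ξ : ℂ) - Complex.I) + 1 / (ξ - -Complex.I)) := by
        simp [g, not_lt.2 hlt.le]
      rw [eg]
      refine h1.congr' ?_
      filter_upwards [h2.eventually_lt_const h3, self_mem_nhdsWithin] with ρ h4 hρ
      rw [averageKernel, if_neg (fun h => absurd ((hnorm ρ hρ).1 h) (not_lt.2 h4.le))]
      ring
    · have h3 : ‖deriv L.param s‖ < |ξ| * ‖deriv L.param s‖ := by nlinarith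
      have eg : g ξ = 1 / 2 * (1 / ((ξ : ℂ) - Complex.I) + 1 / (ξ - -Complex.I)) -
          1 / (ξ - 0) := by
        simp [g, hgt]
      rw [eg]
      have hξ0 : (ξ : ℂ) - 0 ≠ 0 := by
        rw [sub_zero, Complex.ofReal_ne_zero]
        rintro rfl
        simp at hgt; linarith
      refine (h1.sub (tendsto_scaled_kernel (L := L) s ξ hξ0)).congr' ?_
      filter_upwards [h2.eventually_const_lt h3, self_mem_nhdsWithin] with ρ h4 hρ
      rw [averageKernel, if_pos ((hnorm ρ hρ).2 h4)]
      simp only [zero_mul, add_zero]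
      ring

/-- The principal value of `∫_L dτ / (τ - t)`, for `t` on the contour, is `πi`. -/
theorem PositivelyOriented.tendsto_truncatedIntegral_inv (hL : L.PositivelyOriented) {t : ℂ}
    (ht : t ∈ L.carrier) : Tendsto (fun v => L.truncatedIntegral (fun τ => 1 / (τ - t) ^ 1) t v)
      (𝓝[>] 0) (𝓝 (Real.pi * Complex.I)) := by
  obtain ⟨s, rfl⟩ := ht
  have hdpos : 0 < ‖deriv L.param s‖ := norm_pos_iff.2 (L.deriv_ne_zero s)
  -- With `ρ = v / |γ'(s)|` the normal points are at distance exactly `v`, the radius of the removed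
  -- disc.
  have hscale : Tendsto (fun v : ℝ => v / ‖deriv L.param s‖) (𝓝[>] 0) (𝓝[>] 0) := by
    refine tendsto_nhdsWithin_iff.2 ⟨?_, ?_⟩
    · have : Tendsto (fun v : ℝ => v / ‖deriv L.param s‖) (𝓝 0) (𝓝 (0 / ‖deriv L.param s‖)) :=
        (continuous_id.div_const _).tendsto 0
      rw [zero_div] at this
      exact this.mono_left nhdsWithin_le_nhds
    · filter_upwards [self_mem_nhdsWithin] with v hv
      exact div_pos hv hdpos
  have h1 := ((tendsto_integral_averageKernel (L := L) s).comp hscale).const_sub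
    (Real.pi * Complex.I)
  rw [sub_zero] at h1
  refine h1.congr' ?_
  filter_upwards [hscale.eventually (hL.eventually_normalPoint_mem s), self_mem_nhdsWithin]
    with v ⟨hz, hz'⟩ hv
  have hv0 : (0 : ℝ) < v := hv
  have hzc := hz.1
  have hzc' := hz'.1
  simp only [Function.comp_apply, averageKernel]
  rw [truncatedIntegral_eq, L.contourIntegral_eq_shift _ s]
  have c1 := cauchyIntegral_one_shift (L := L) s (L.normalPoint s (v / ‖deriv L.param s‖))
  have c2 := cauchyIntegral_one_shift (L := L) s (L.normalPoint s (-(v / ‖deriv L.param s‖)))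
  have i1 := intervalIntegrable_shifted_kernel s hzc (-(1 / 2)) (1 / 2)
  have i2 := intervalIntegrable_shifted_kernel s hzc' (-(1 / 2)) (1 / 2)
  -- The Cauchy integrals of `1` are `2πi` at the inner point and `0` at the outer one, so the
  -- average is `πi`.
  rw [cauchyIntegral_one_eq, hL _ hz] at c1
  rw [cauchyIntegral_one_eq, L.windingNumber_eq_zero_of_not_mem_inner hz'.1 hz'.2] at c2
  rw [normalPoint_neg] at c2 i2
  rw [normalPoint] at c1 i1
  have i3 : IntervalIntegrable (fun σ => if v < ‖L.param (s + σ) - L.param s‖ then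
      1 / (L.param (s + σ) - L.param s) * deriv L.param (s + σ) else 0) volume
      (-(1 / 2)) (1 / 2) := by
    have := (intervalIntegrable_truncated (L := L) (u := 1) continuousOn_const 1 (L.param s)
      hv0 (s + -(1 / 2)) (s + 1 / 2)).comp_add_left s
    simpa [ite_mul] using this
  rw [intervalIntegral.integral_sub ((i1.add i2).const_mul _), intervalIntegral.integral_const_mul,
    intervalIntegral.integral_add i1 i2, ← c1, ← c2, div_mul_cancel₀ _ hdpos.ne']
  · simp only [pow_one, ite_mul, zero_mul]
    ring
  · rwa [div_mul_cancel₀ _ hdpos.ne']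

end SmoothClosedContour

/-! ### Hölder densities and the limits of their Cauchy integrals on the contour. -/

lemma intervalIntegrable_abs_rpow {r : ℝ} (hr : -1 < r) (a b : ℝ) :
    IntervalIntegrable (fun x : ℝ => |x| ^ r) volume a b := by
  have hpos : ∀ b, 0 ≤ b → IntervalIntegrable (fun x : ℝ => |x| ^ r) volume 0 b := fun b hb => by
    refine (intervalIntegral.intervalIntegrable_rpow' (a := 0) (b := b) hr).congr ?_
    intro x hx
    rw [uIoc_of_le hb] at hx
    simp only [abs_of_pos hx.1]
  have hall : ∀ b, IntervalIntegrable (fun x : ℝ => |x| ^ r) volume 0 b := fun b => by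
    rcases le_total 0 b with h | h
    · exact hpos b h
    · have := (hpos (-b) (neg_nonneg.2 h)).comp_sub_left 0
      simpa using this
  exact (hall a).symm.trans (hall b)

namespace SmoothClosedContour

variable {L : SmoothClosedContour}

variable (L) in
/-- The Hölder condition with exponent `α` on the contour. -/
def IsHolder (α : ℝ) (u : ℂ → ℂ) : Prop :=
  ∃ M : ℝ, ∀ s ∈ L.carrier, ∀ t ∈ L.carrier, ‖u s - u t‖ ≤ M * ‖s - t‖ ^ α

lemma IsHolder.exists_pos {α : ℝ} {u : ℂ → ℂ} (hu : L.IsHolder α u) : ∃ M > 0,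
    ∀ s ∈ L.carrier, ∀ t ∈ L.carrier, ‖u s - u t‖ ≤ M * ‖s - t‖ ^ α := by
  obtain ⟨M, hM⟩ := hu
  refine ⟨max M 1, by positivity, fun s hs t ht => (hM s hs t ht).trans ?_⟩
  gcongr
  exact le_max_left _ _

lemma IsHolder.continuousOn {α : ℝ} (hα : 0 < α) {u : ℂ → ℂ} (hu : L.IsHolder α u) :
    ContinuousOn u L.carrier := by
  obtain ⟨M, hM⟩ := hu
  intro t ht
  rw [ContinuousWithinAt, tendsto_iff_norm_sub_tendsto_zero]
  have h1 : Tendsto (fun s : ℂ => M * ‖s - t‖ ^ α) (𝓝[L.carrier] t) (𝓝 0) := by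
    have : ContinuousAt (fun s : ℂ => M * ‖s - t‖ ^ α) t :=
      continuousAt_const.mul ((continuousAt_id.sub continuousAt_const).norm.rpow_const
        (Or.inr hα.le))
    have h := this.tendsto
    simp only [sub_self, norm_zero, Real.zero_rpow hα.ne', mul_zero] at h
    exact h.mono_left nhdsWithin_le_nhds
  refine squeeze_zero' (Eventually.of_forall fun _ => norm_nonneg _) ?_ h1
  filter_upwards [self_mem_nhdsWithin] with s hs using hM s hs t ht

/-- By the chord-arc inequality, nearby points of `L` have nearby parameters, up to the period. -/
lemma continuousOn_of_continuous_comp_param {f : ℂ → ℂ} (hf : Continuous fun s => f (L.param s)) :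
    ContinuousOn f L.carrier := by
  obtain ⟨c, hc, H⟩ := L.exists_chord_arc
  rintro _ ⟨s, rfl⟩
  rw [Metric.continuousWithinAt_iff]
  intro ε hε
  obtain ⟨δ, hδ, hδf⟩ := Metric.continuous_iff.1 hf s ε hε
  refine ⟨c * δ, by positivity, fun τ hτ hd => ?_⟩
  obtain ⟨σ, hσ, rfl⟩ := L.exists_shift_eq s hτ
  refine hδf _ ?_
  rw [dist_eq_norm] at hd
  rw [Real.dist_eq, add_sub_cancel_left]
  exact lt_of_mul_lt_mul_left ((H s σ hσ).trans_lt hd) hc.le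

variable (L) in
/-- The integral `∫_L (u(τ) - u(t)) / (τ - t) dτ`. -/
noncomputable def differenceIntegral (u : ℂ → ℂ) (t : ℂ) : ℂ :=
  L.contourIntegral fun τ => (u τ - u t) / (τ - t)

lemma continuous_shift (s : ℝ) : Continuous fun σ : ℝ => L.param (s + σ) :=
  L.continuous_param.comp (continuous_const_add s)

lemma continuous_deriv_shift (s : ℝ) : Continuous fun σ : ℝ => deriv L.param (s + σ) :=
  L.continuous_deriv_param.comp (continuous_const_add s)

/-- A uniform bound, along the contour, for kernels of the size of a power of the distance. -/
lemma exists_rpow_bound {β : ℝ} (hβ1 : β ≤ 1) : ∃ C > 0, ∀ s σ : ℝ, σ ≠ 0 → |σ| ≤ 1 / 2 →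
    ‖L.param (s + σ) - L.param s‖ ^ (β - 1) * ‖deriv L.param (s + σ)‖ ≤ C * |σ| ^ (β - 1) := by
  obtain ⟨m, M, hm, hM, hmM⟩ := L.exists_deriv_bounds
  obtain ⟨c, hc, H⟩ := L.exists_chord_arc
  refine ⟨c ^ (β - 1) * M, by positivity, fun s σ hσ0 hσ => ?_⟩
  have h0 : 0 < |σ| := abs_pos.2 hσ0
  calc ‖L.param (s + σ) - L.param s‖ ^ (β - 1) * ‖deriv L.param (s + σ)‖
      ≤ (c * |σ|) ^ (β - 1) * M := by
        gcongr ?_ * ?_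
        · exact Real.rpow_le_rpow_of_nonpos (by positivity) (H s σ hσ) (by linarith)
        · exact (hmM _).2
    _ = _ := by rw [Real.mul_rpow hc.le h0.le]; ring

lemma IsHolder.exists_norm_difference_le {α : ℝ} (hα1 : α ≤ 1) {u : ℂ → ℂ}
    (hu : L.IsHolder α u) : ∃ C > 0, ∀ s σ : ℝ, σ ≠ 0 → |σ| ≤ 1 / 2 →
    ‖(u (L.param (s + σ)) - u (L.param s)) / (L.param (s + σ) - L.param s) *
      deriv L.param (s + σ)‖ ≤ C * |σ| ^ (α - 1) := by
  obtain ⟨K, hK, hKu⟩ := hu.exists_pos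
  obtain ⟨C, hC, H⟩ := exists_rpow_bound (L := L) hα1
  refine ⟨K * C, by positivity, fun s σ hσ0 hσ => ?_⟩
  have hpos : 0 < ‖L.param (s + σ) - L.param s‖ :=
    norm_pos_iff.2 (sub_ne_zero.2 (L.param_add_ne hσ0 hσ))
  rw [norm_mul, norm_div]
  calc ‖u (L.param (s + σ)) - u (L.param s)‖ / ‖L.param (s + σ) - L.param s‖ *
        ‖deriv L.param (s + σ)‖
      ≤ K * ‖L.param (s + σ) - L.param s‖ ^ α / ‖L.param (s + σ) - L.param s‖ *
        ‖deriv L.param (s + σ)‖ := by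
        gcongr
        exact hKu _ (L.param_mem_carrier _) _ (L.param_mem_carrier _)
    _ = K * (‖L.param (s + σ) - L.param s‖ ^ (α - 1) * ‖deriv L.param (s + σ)‖) := by
        rw [Real.rpow_sub_one hpos.ne']; ring
    _ ≤ K * (C * |σ| ^ (α - 1)) := mul_le_mul_of_nonneg_left (H s σ hσ0 hσ) hK.le
    _ = _ := by ring

lemma abs_le_half_of_mem_uIoc {σ : ℝ} (h : σ ∈ uIoc (-(1 / 2) : ℝ) (1 / 2)) : |σ| ≤ 1 / 2 := by
  rw [uIoc_of_le (by norm_num)] at h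
  exact abs_le.2 ⟨h.1.le, h.2⟩

lemma ae_ne_zero : ∀ᵐ σ : ℝ, σ ≠ 0 := by
  have : ∀ᵐ σ : ℝ, σ ∉ ({0} : Set ℝ) := measure_eq_zero_iff_ae_notMem.1 Real.volume_singleton
  simpa using this

lemma measurable_difference {u : ℂ → ℂ} (hu : ContinuousOn u L.carrier) (s : ℝ) (z k : ℂ) :
    Measurable fun σ : ℝ => (u (L.param (s + σ)) - k) / (L.param (s + σ) - z) *
      deriv L.param (s + σ) := by
  have h1 : Measurable fun σ : ℝ => u (L.param (s + σ)) :=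
    ((L.continuous_comp_param hu).comp (continuous_const_add s)).measurable
  exact ((h1.sub_const k).div ((continuous_shift s).measurable.sub_const z)).mul
    (continuous_deriv_shift s).measurable

lemma IsHolder.intervalIntegrable_difference {α : ℝ} (hα : 0 < α) (hα1 : α ≤ 1) {u : ℂ → ℂ}
    (hu : L.IsHolder α u) (s : ℝ) : IntervalIntegrable (fun σ =>
      (u (L.param (s + σ)) - u (L.param s)) / (L.param (s + σ) - L.param s) *
        deriv L.param (s + σ)) volume (-(1 / 2)) (1 / 2) := by
  obtain ⟨C, hC, H⟩ := hu.exists_norm_difference_le hα1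
  refine ((intervalIntegrable_abs_rpow (r := α - 1) (by linarith) _ _).const_mul C).mono_fun'
    (measurable_difference (hu.continuousOn hα) s _ _).aestronglyMeasurable ?_
  refine (ae_restrict_iff' measurableSet_uIoc).2 ?_
  filter_upwards [ae_ne_zero] with σ hσ0 hσ
  exact H s σ hσ0 (abs_le_half_of_mem_uIoc hσ)

/-- Recentring the parameter at `s` fixes the singularity at `σ = 0`, so that `C |σ|^{α-1}`
dominates the integrands for all `s` at once. -/
lemma IsHolder.continuousOn_differenceIntegral {α : ℝ} (hα : 0 < α) (hα1 : α ≤ 1) {u : ℂ → ℂ}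
    (hu : L.IsHolder α u) : ContinuousOn (L.differenceIntegral u) L.carrier := by
  obtain ⟨C, hC, H⟩ := hu.exists_norm_difference_le hα1
  have huc := L.continuous_comp_param (hu.continuousOn hα)
  refine continuousOn_of_continuous_comp_param ?_
  have e : (fun s => L.differenceIntegral u (L.param s)) = fun s =>
      ∫ σ in (-(1 / 2) : ℝ)..(1 / 2), (u (L.param (s + σ)) - u (L.param s)) /
        (L.param (s + σ) - L.param s) * deriv L.param (s + σ) := by
    ext s
    rw [differenceIntegral, L.contourIntegral_eq_shift _ s]
  rw [e]
  refine intervalIntegral.continuous_of_dominated_interval (bound := fun σ => C * |σ| ^ (α - 1))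
    (fun s => (measurable_difference (hu.continuousOn hα) s _ _).aestronglyMeasurable) ?_
    ((intervalIntegrable_abs_rpow (r := α - 1) (by linarith) _ _).const_mul C) ?_
  · intro s
    filter_upwards [ae_ne_zero] with σ hσ0 hσ
    exact H s σ hσ0 (abs_le_half_of_mem_uIoc hσ)
  · filter_upwards [ae_ne_zero] with σ hσ0 hσ
    have h1 : Continuous fun s : ℝ => s + σ := continuous_add_const σ
    exact ((huc.comp h1).sub huc).div₀ ((L.continuous_param.comp h1).sub L.continuous_param)
      (fun s => sub_ne_zero.2 (L.param_add_ne hσ0 (abs_le_half_of_mem_uIoc hσ))) |>.mul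
      (L.continuous_deriv_param.comp h1)

lemma intervalIntegrable_shifted_difference {u : ℂ → ℂ} (hu : ContinuousOn u L.carrier) (s : ℝ)
    {z : ℂ} (hz : z ∉ L.carrier) (k : ℂ) (a b : ℝ) : IntervalIntegrable (fun σ =>
      (u (L.param (s + σ)) - k) / (L.param (s + σ) - z) * deriv L.param (s + σ)) volume a b := by
  have := (L.continuous_cauchy_integrand (u := fun τ => u τ - k) (hu.sub continuousOn_const) 1
    hz).comp (continuous_const_add s)
  refine Continuous.intervalIntegrable ?_ _ _
  simpa [Function.comp_def] using this

/-- The Cauchy integral of `u - u(t)`, where `t` is the point of the contour nearest to `z`, differs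
little from its value at `t`. -/
lemma IsHolder.exists_norm_sub_differenceIntegral_le {α : ℝ} (hα : 0 < α) (hα1 : α ≤ 1) {u : ℂ → ℂ}
    (hu : L.IsHolder α u) : ∃ C, ∀ z ∉ L.carrier, ∀ s,
      (∀ s', ‖z - L.param s‖ ≤ ‖z - L.param s'‖) →
      ‖L.contourIntegral (fun τ => (u τ - u (L.param s)) / (τ - z)) -
        L.differenceIntegral u (L.param s)‖ ≤ C * ‖z - L.param s‖ ^ (α / 2) := by
  obtain ⟨K, hK, hKu⟩ := hu.exists_pos
  obtain ⟨C, hC, H⟩ := exists_rpow_bound (L := L) (β := α / 2) (by linarith)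
  refine ⟨K * 2 ^ (α / 2) * C * ∫ σ in (-(1 / 2) : ℝ)..(1 / 2), |σ| ^ (α / 2 - 1),
    fun z hz s hs => ?_⟩
  have hcont := hu.continuousOn hα
  have i1 := intervalIntegrable_shifted_difference hcont s hz (u (L.param s)) (-(1 / 2)) (1 / 2)
  have i2 := hu.intervalIntegrable_difference hα hα1 s
  rw [differenceIntegral, L.contourIntegral_eq_shift _ s, L.contourIntegral_eq_shift _ s,
    ← intervalIntegral.integral_sub i1 i2]
  set r := ‖z - L.param s‖ with hr
  have hr0 : 0 < r := norm_pos_iff.2 (sub_ne_zero.2 fun h => hz (h ▸ L.param_mem_carrier s))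
  have ib : IntervalIntegrable (fun σ : ℝ => K * 2 ^ (α / 2) * C * r ^ (α / 2) * |σ| ^ (α / 2 - 1))
      volume (-(1 / 2)) (1 / 2) :=
    (intervalIntegrable_abs_rpow (by linarith) _ _).const_mul _
  refine (intervalIntegral.norm_integral_le_of_norm_le (by norm_num) ?_ ib).trans (le_of_eq ?_)
  · filter_upwards [ae_ne_zero] with σ hσ0 hσ
    have hσ' : |σ| ≤ 1 / 2 := abs_le.2 ⟨hσ.1.le, hσ.2⟩
    have hτ := L.param_mem_carrier (s + σ)
    have hH := H s σ hσ0 hσ'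
    have hKu' := hKu _ hτ _ (L.param_mem_carrier s)
    have hτt := sub_ne_zero.2 (L.param_add_ne (s := s) hσ0 hσ')
    have hτz := L.param_sub_ne hz (s + σ)
    have hB := hs (s + σ)
    set τ := L.param (s + σ)
    set t := L.param s
    set d := deriv L.param (s + σ)
    have hA0 : 0 < ‖τ - t‖ := norm_pos_iff.2 hτt
    have hB0 : 0 < ‖τ - z‖ := norm_pos_iff.2 hτz
    rw [norm_sub_rev z τ] at hB
    -- Here `t` being nearest to `z` is used: `|z - t| ≤ |τ - z|`.
    have hAB : ‖τ - t‖ / 2 ≤ ‖τ - z‖ := by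
      have : ‖τ - t‖ ≤ ‖τ - z‖ + ‖z - t‖ := norm_sub_le_norm_sub_add_norm_sub _ _ _
      linarith
    have e : (u τ - u t) / (τ - z) * d - (u τ - u t) / (τ - t) * d =
        (u τ - u t) * ((z - t) / (τ - z)) / (τ - t) * d := by
      field_simp; ring
    -- Half of the Hölder exponent is spent here to gain the factor `r^{α/2}`; the other half keeps
    -- `|τ - t|^{α/2 - 1}` integrable.
    have hratio : r / ‖τ - z‖ ≤ (2 ^ (α / 2) * r ^ (α / 2)) / ‖τ - t‖ ^ (α / 2) := by
      have h1 : r / ‖τ - z‖ ≤ 1 := (div_le_one hB0).2 hB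
      calc r / ‖τ - z‖ ≤ (r / ‖τ - z‖) ^ (α / 2) := by
            conv_lhs => rw [← Real.rpow_one (r / ‖τ - z‖)]
            exact Real.rpow_le_rpow_of_exponent_ge (by positivity) h1 (by linarith)
        _ ≤ (2 * r / ‖τ - t‖) ^ (α / 2) := by
            gcongr ?_ ^ _
            rw [div_le_div_iff₀ hB0 hA0]
            nlinarith
        _ = _ := by
            rw [Real.div_rpow (by positivity) hA0.le, Real.mul_rpow (by norm_num) hr0.le]
    rw [e, norm_mul, norm_div, norm_mul, norm_div]
    calc ‖u τ - u t‖ * (r / ‖τ - z‖) / ‖τ - t‖ * ‖d‖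
        ≤ K * ‖τ - t‖ ^ α * ((2 ^ (α / 2) * r ^ (α / 2)) / ‖τ - t‖ ^ (α / 2)) / ‖τ - t‖ * ‖d‖ := by
          gcongr
      _ = K * 2 ^ (α / 2) * r ^ (α / 2) * (‖τ - t‖ ^ (α / 2 - 1) * ‖d‖) := by
          have h2 : ‖τ - t‖ ^ α = ‖τ - t‖ ^ (α / 2) * ‖τ - t‖ ^ (α / 2) := by
            rw [← Real.rpow_add hA0]; congr 1; ring
          rw [h2, Real.rpow_sub_one hA0.ne']
          field_simp
      _ ≤ K * 2 ^ (α / 2) * r ^ (α / 2) * (C * |σ| ^ (α / 2 - 1)) :=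
          mul_le_mul_of_nonneg_left hH (by positivity)
      _ = _ := by ring
  · rw [intervalIntegral.integral_const_mul]; ring

lemma contourIntegral_sub_const_div {u : ℂ → ℂ} (hu : ContinuousOn u L.carrier) {z : ℂ}
    (hz : z ∉ L.carrier) (k : ℂ) : L.contourIntegral (fun τ => (u τ - k) / (τ - z)) =
      L.cauchyIntegral u 1 z - 2 * Real.pi * Complex.I * L.windingNumber z * k := by
  have h1 := (L.continuous_cauchy_integrand hu 1 hz).intervalIntegrable (μ := volume) 0 1
  have h2 := (L.continuous_cauchy_integrand (u := 1) continuousOn_const 1 hz).intervalIntegrable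
    (μ := volume) 0 1
  rw [← cauchyIntegral_one_eq, cauchyIntegral, cauchyIntegral, contourIntegral, contourIntegral,
    contourIntegral, mul_comm _ k, ← intervalIntegral.integral_const_mul,
    ← intervalIntegral.integral_sub h1 (h2.const_mul k)]
  refine intervalIntegral.integral_congr fun s _ => ?_
  simp only [pow_one, Pi.one_apply]
  ring

lemma windingNumber_norm_le (hL : L.PositivelyOriented) {z : ℂ} (hz : z ∉ L.carrier) :
    ‖L.windingNumber z‖ ≤ 1 := by
  by_cases h : z ∈ L.inner
  · simp [hL z h]
  · simp [L.windingNumber_eq_zero_of_not_mem_inner hz h]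

/-- The limits of a Cauchy integral with Hölder density at a point of the contour. -/
theorem IsHolder.tendsto_cauchyIntegral {α : ℝ} (hα : 0 < α) (hα1 : α ≤ 1) {u : ℂ → ℂ}
    (hu : L.IsHolder α u) (hL : L.PositivelyOriented) {t : ℂ} (ht : t ∈ L.carrier) :
    Tendsto (fun z => L.cauchyIntegral u 1 z - 2 * Real.pi * Complex.I * L.windingNumber z * u t)
      (𝓝[L.carrierᶜ] t) (𝓝 (L.differenceIntegral u t)) := by
  obtain ⟨C, hC⟩ := hu.exists_norm_sub_differenceIntegral_le hα hα1
  have hcont := hu.continuousOn hα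
  choose N hN using L.exists_mem_carrier_dist_eq
  have hid : Tendsto (fun z : ℂ => ‖z - t‖) (𝓝[L.carrierᶜ] t) (𝓝 0) := by
    have : Continuous fun z : ℂ => ‖z - t‖ := by fun_prop
    have h := this.tendsto t
    rw [sub_self, norm_zero] at h
    exact h.mono_left nhdsWithin_le_nhds
  have hle : ∀ z, ‖z - L.param (N z)‖ ≤ ‖z - t‖ := fun z => by
    obtain ⟨s, rfl⟩ := ht
    exact hN z s
  have hdist : Tendsto (fun z => ‖z - L.param (N z)‖) (𝓝[L.carrierᶜ] t) (𝓝 0) :=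
    squeeze_zero (fun _ => norm_nonneg _) hle hid
  have hNt : Tendsto (fun z => L.param (N z)) (𝓝[L.carrierᶜ] t) (𝓝[L.carrier] t) := by
    refine tendsto_nhdsWithin_iff.2 ⟨?_, Eventually.of_forall fun z => L.param_mem_carrier _⟩
    rw [tendsto_iff_norm_sub_tendsto_zero]
    refine squeeze_zero (fun _ => norm_nonneg _) (fun z => ?_)
      (show Tendsto (fun z => ‖z - t‖ + ‖z - t‖) _ (𝓝 0) by simpa using hid.add hid)
    calc ‖L.param (N z) - t‖ ≤ ‖L.param (N z) - z‖ + ‖z - t‖ :=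
          norm_sub_le_norm_sub_add_norm_sub _ _ _
      _ ≤ _ := by rw [norm_sub_rev (L.param (N z))]; gcongr; exact hle z
  have hSt := (hu.continuousOn_differenceIntegral hα hα1 t ht).tendsto.comp hNt
  have hut := (hcont t ht).tendsto.comp hNt
  -- Pass through the nearest point `γ(N z)`: the integral centred there is close to
  -- `differenceIntegral` at that point, which is continuous along `L`. Replacing `u(γ(N z))` by
  -- `u(t)` costs a bounded winding number times a quantity tending to `0`.
  have h1 : Tendsto (fun z => L.contourIntegral (fun τ => (u τ - u (L.param (N z))) / (τ - z)) -
      L.differenceIntegral u (L.param (N z))) (𝓝[L.carrierᶜ] t) (𝓝 0) := by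
    refine squeeze_zero_norm' (a := fun z => C * ‖z - L.param (N z)‖ ^ (α / 2)) ?_ ?_
    · filter_upwards [self_mem_nhdsWithin] with z hz using hC z hz (N z) (hN z)
    · have := (hdist.rpow_const (p := α / 2) (Or.inr (by linarith))).const_mul C
      rwa [Real.zero_rpow (by linarith), mul_zero] at this
  have h2 : Tendsto (fun z => 2 * Real.pi * Complex.I * L.windingNumber z *
      (u (L.param (N z)) - u t)) (𝓝[L.carrierᶜ] t) (𝓝 0) := by
    have h3 : Tendsto (fun z => 2 * Real.pi * ‖u (L.param (N z)) - u t‖) (𝓝[L.carrierᶜ] t)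
        (𝓝 0) := by
      have := (tendsto_iff_norm_sub_tendsto_zero.1 hut).const_mul (2 * Real.pi)
      rwa [mul_zero] at this
    refine squeeze_zero_norm' ?_ h3
    filter_upwards [self_mem_nhdsWithin] with z hz
    have hw := windingNumber_norm_le hL hz
    rw [norm_mul, norm_mul]
    have e : ‖(2 : ℂ) * Real.pi * Complex.I‖ = 2 * Real.pi := by
      simp [abs_of_pos Real.pi_pos]
    rw [e]
    have : 2 * Real.pi * ‖L.windingNumber z‖ ≤ 2 * Real.pi * 1 := by gcongr
    rw [mul_one] at this
    gcongr
  have h := (h1.add hSt).add h2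
  rw [zero_add, add_zero] at h
  refine h.congr' ?_
  filter_upwards [self_mem_nhdsWithin] with z hz
  rw [contourIntegral_sub_const_div hcont hz]
  simp only [Function.comp_apply]
  ring

lemma inner_subset_compl : L.inner ⊆ L.carrierᶜ := fun _ h => h.1

lemma outer_subset_compl : L.outer ⊆ L.carrierᶜ := fun _ h => h.1

lemma IsHolder.tendsto_cauchyIntegral_inner {α : ℝ} (hα : 0 < α) (hα1 : α ≤ 1) {u : ℂ → ℂ}
    (hu : L.IsHolder α u) (hL : L.PositivelyOriented) {t : ℂ} (ht : t ∈ L.carrier) :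
    Tendsto (L.cauchyIntegral u 1) (𝓝[L.inner] t)
      (𝓝 (L.differenceIntegral u t + 2 * Real.pi * Complex.I * u t)) := by
  have h := ((hu.tendsto_cauchyIntegral hα hα1 hL ht).mono_left
    (nhdsWithin_mono t inner_subset_compl)).add_const (2 * Real.pi * Complex.I * u t)
  refine h.congr' ?_
  filter_upwards [self_mem_nhdsWithin] with z hz
  rw [hL z hz]; ring

lemma IsHolder.tendsto_cauchyIntegral_outer {α : ℝ} (hα : 0 < α) (hα1 : α ≤ 1) {u : ℂ → ℂ}
    (hu : L.IsHolder α u) (hL : L.PositivelyOriented) {t : ℂ} (ht : t ∈ L.carrier) :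
    Tendsto (L.cauchyIntegral u 1) (𝓝[L.outer] t) (𝓝 (L.differenceIntegral u t)) := by
  have h := (hu.tendsto_cauchyIntegral hα hα1 hL ht).mono_left
    (nhdsWithin_mono t outer_subset_compl)
  refine h.congr' ?_
  filter_upwards [self_mem_nhdsWithin] with z hz
  rw [L.windingNumber_eq_zero_of_not_mem_inner hz.1 hz.2]; ring

/-! ### Cauchy's theorem up to the boundary. -/

lemma compl_carrier_eq : L.carrierᶜ = L.inner ∪ L.outer := by
  ext z
  by_cases h : z ∈ L.inner
  · simp [h, h.1]
  · simp [outer, h]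

open Classical in
variable (L) in
/-- The defect in Cauchy's formula for `x`. -/
noncomputable def cauchyDefect (x : ℂ → ℂ) (z : ℂ) : ℂ :=
  if z ∈ L.carrier then L.differenceIntegral x z
  else if z ∈ L.inner then L.cauchyIntegral x 1 z - 2 * Real.pi * Complex.I * x z
  else L.cauchyIntegral x 1 z

lemma cauchyDefect_carrier (x : ℂ → ℂ) {z : ℂ} (hz : z ∈ L.carrier) :
    L.cauchyDefect x z = L.differenceIntegral x z := if_pos hz

lemma cauchyDefect_inner (x : ℂ → ℂ) {z : ℂ} (hz : z ∈ L.inner) :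
    L.cauchyDefect x z = L.cauchyIntegral x 1 z - 2 * Real.pi * Complex.I * x z := by
  rw [cauchyDefect, if_neg hz.1, if_pos hz]

lemma cauchyDefect_outer (x : ℂ → ℂ) {z : ℂ} (hz : z ∈ L.outer) :
    L.cauchyDefect x z = L.cauchyIntegral x 1 z := by
  rw [cauchyDefect, if_neg hz.1, if_neg hz.2]

/-- **Cauchy's theorem** for a function that is holomorphic inside a smooth closed contour,
continuous up to it, and Hölder continuous on it. -/
theorem IsHolder.cauchyDefect_eq_zero {α : ℝ} (hα : 0 < α) (hα1 : α ≤ 1) {x : ℂ → ℂ}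
    (hx : L.IsHolder α x) (hL : L.PositivelyOriented) (hxa : DifferentiableOn ℂ x L.inner)
    (hxc : ContinuousOn x (closure L.inner)) (z : ℂ) : L.cauchyDefect x z = 0 := by
  have hcont := hx.continuousOn hα
  have hdiff : ∀ z ∉ L.carrier, DifferentiableAt ℂ (L.cauchyDefect x) z := by
    intro z hz
    have hC := (L.hasDerivAt_cauchyIntegral hcont 1 hz).differentiableAt
    by_cases h : z ∈ L.inner
    · refine (hC.sub ((hxa.differentiableAt (hL.isOpen_inner.mem_nhds h)).const_mul
        (2 * Real.pi * Complex.I))).congr_of_eventuallyEq ?_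
      filter_upwards [hL.isOpen_inner.mem_nhds h] with y hy using cauchyDefect_inner x hy
    · refine hC.congr_of_eventuallyEq ?_
      filter_upwards [hL.isOpen_outer.mem_nhds ⟨hz, h⟩] with y hy using cauchyDefect_outer x hy
  have hc : Continuous (L.cauchyDefect x) := by
    refine continuous_iff_continuousAt.2 fun t => ?_
    by_cases ht : t ∈ L.carrier
    · have hu : (univ : Set ℂ) = L.carrier ∪ (L.inner ∪ L.outer) := by
        rw [← compl_carrier_eq, union_compl_self]
      rw [ContinuousAt, ← nhdsWithin_univ, hu, nhdsWithin_union, nhdsWithin_union,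
        cauchyDefect_carrier x ht]
      -- The limits along `L`, from inside and from outside all equal `differenceIntegral x t`; from
      -- inside, the Plemelj term `2πi x(t)` cancels against the subtracted `2πi x(z)`.
      refine (Tendsto.sup ?_ (Tendsto.sup ?_ ?_))
      · refine (hx.continuousOn_differenceIntegral hα hα1 t ht).tendsto.congr' ?_
        filter_upwards [self_mem_nhdsWithin] with y hy using (cauchyDefect_carrier x hy).symm
      · have h1 := ((hxc t (hL.carrier_subset_closure_inner ht)).tendsto.mono_left
          (nhdsWithin_mono t subset_closure)).const_mul (2 * Real.pi * Complex.I)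
        have h2 := (hx.tendsto_cauchyIntegral_inner hα hα1 hL ht).sub h1
        rw [add_sub_cancel_right] at h2
        refine h2.congr' ?_
        filter_upwards [self_mem_nhdsWithin] with y hy using (cauchyDefect_inner x hy).symm
      · refine (hx.tendsto_cauchyIntegral_outer hα hα1 hL ht).congr' ?_
        filter_upwards [self_mem_nhdsWithin] with y hy using (cauchyDefect_outer x hy).symm
    · exact (hdiff t ht).continuousAt
  obtain ⟨m, M, hm, hM, hmM⟩ := L.exists_deriv_bounds
  have hent : Differentiable ℂ (L.cauchyDefect x) :=
    differentiable_of_continuous_of_differentiableAt_off_curve hc hM.le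
      (L.norm_param_sub_le fun s => (hmM s).2) (by rwa [← carrier_eq_image])
  -- Liouville: far away only the outer branch is seen, and it tends to `0`.
  refine hent.apply_eq_of_tendsto_cocompact z ?_
  refine (L.tendsto_cauchyIntegral_cocompact hcont).congr' ?_
  have hb : Bornology.IsBounded (L.carrier ∪ L.inner) :=
    L.isCompact_carrier.isBounded.union hL.isBounded_inner
  rw [← Metric.cobounded_eq_cocompact]
  filter_upwards [Bornology.isBounded_def.1 hb] with y hy
  rw [mem_compl_iff, mem_union, not_or] at hy
  exact (cauchyDefect_outer x hy).symm

/-! ### Calculus along the contour and the classes `W^r H_α`. -/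

lemma accPt_carrier {t : ℂ} (ht : t ∈ L.carrier) : AccPt t (𝓟 L.carrier) := by
  obtain ⟨s, rfl⟩ := ht
  rw [accPt_principal_iff_nhdsWithin]
  have h : Tendsto (fun σ : ℝ => L.param (s + σ)) (𝓝[>] 0)
      (𝓝[L.carrier \ {L.param s}] (L.param s)) := by
    refine tendsto_nhdsWithin_iff.2 ⟨?_, ?_⟩
    · have := (continuous_shift (L := L) s).tendsto 0
      rw [add_zero] at this
      exact this.mono_left nhdsWithin_le_nhds
    · filter_upwards [Ioc_mem_nhdsGT (show (0 : ℝ) < 1 / 2 by norm_num)] with σ hσ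
      exact ⟨L.param_mem_carrier _, L.param_add_ne hσ.1.ne' (by rw [abs_of_pos hσ.1]; exact hσ.2)⟩
  exact h.neBot

lemma uniqueDiffOn_carrier : UniqueDiffOn ℂ L.carrier := fun _ ht =>
  (accPt_carrier ht).uniqueDiffWithinAt

lemma derivAlong_zero (u : ℂ → ℂ) : L.derivAlong 0 u = u := iteratedDerivWithin_zero

lemma derivAlong_succ (k : ℕ) (u : ℂ → ℂ) :
    L.derivAlong (k + 1) u = derivWithin (L.derivAlong k u) L.carrier := iteratedDerivWithin_succ

lemma derivAlong_succ' (k : ℕ) (u : ℂ → ℂ) :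
    L.derivAlong (k + 1) u = L.derivAlong k (L.derivAlong 1 u) := by
  simp only [derivAlong, iteratedDerivWithin_succ', iteratedDerivWithin_zero]

lemma hasDerivAt_comp_param {u : ℂ → ℂ} {s : ℝ}
    (hu : DifferentiableWithinAt ℂ u L.carrier (L.param s)) :
    HasDerivAt (fun s => u (L.param s))
      (derivWithin u L.carrier (L.param s) * deriv L.param s) s :=
  HasDerivWithinAt.comp_hasDerivAt (h := L.param) (h₂ := u) s hu.hasDerivWithinAt
    (L.hasDerivAt_param s) (Eventually.of_forall L.param_mem_carrier)

lemma IsHolder.add {α : ℝ} {u v : ℂ → ℂ} (hu : L.IsHolder α u) (hv : L.IsHolder α v) :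
    L.IsHolder α (fun τ => u τ + v τ) := by
  obtain ⟨A, hA⟩ := hu
  obtain ⟨B, hB⟩ := hv
  refine ⟨A + B, fun s hs t ht => ?_⟩
  rw [add_sub_add_comm, add_mul]
  exact (norm_add_le _ _).trans (add_le_add (hA s hs t ht) (hB s hs t ht))

lemma IsHolder.const {α : ℝ} (k : ℂ) : L.IsHolder α (fun _ => k) :=
  ⟨0, fun _ _ _ _ => by simp⟩

lemma IsHolder.sum {α : ℝ} {ι : Type*} (F : Finset ι) {u : ι → ℂ → ℂ}
    (hu : ∀ i ∈ F, L.IsHolder α (u i)) : L.IsHolder α (fun τ => ∑ i ∈ F, u i τ) := by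
  classical
  induction F using Finset.induction_on with
  | empty => simpa using IsHolder.const 0
  | insert i F hi ih =>
    simp only [Finset.sum_insert hi]
    exact (hu i (Finset.mem_insert_self i F)).add
      (ih fun j hj => hu j (Finset.mem_insert_of_mem hj))

lemma IsHolder.mul {α : ℝ} (hα : 0 < α) {u v : ℂ → ℂ} (hu : L.IsHolder α u)
    (hv : L.IsHolder α v) : L.IsHolder α (fun τ => u τ * v τ) := by
  obtain ⟨P, hP⟩ := L.isCompact_carrier.exists_bound_of_continuousOn (hu.continuousOn hα)
  obtain ⟨Q, hQ⟩ := L.isCompact_carrier.exists_bound_of_continuousOn (hv.continuousOn hα)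
  obtain ⟨A, hA⟩ := hu
  obtain ⟨B, hB⟩ := hv
  refine ⟨A * Q + P * B, fun s hs t ht => ?_⟩
  have e : u s * v s - u t * v t = (u s - u t) * v s + u t * (v s - v t) := by ring
  have h1 := hA s hs t ht
  have h2 := hB s hs t ht
  have h3 := hQ s hs
  have h4 := hP t ht
  calc ‖u s * v s - u t * v t‖ ≤ ‖(u s - u t) * v s‖ + ‖u t * (v s - v t)‖ := by
        rw [e]; exact norm_add_le _ _
    _ ≤ A * ‖s - t‖ ^ α * Q + P * (B * ‖s - t‖ ^ α) := by
        rw [norm_mul, norm_mul]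
        have h5 := (norm_nonneg _).trans h1
        have h6 := (norm_nonneg _).trans h4
        gcongr
    _ = _ := by ring

lemma IsHolder.congr {α : ℝ} {u v : ℂ → ℂ} (hu : L.IsHolder α u) (h : EqOn v u L.carrier) :
    L.IsHolder α v := by
  obtain ⟨A, hA⟩ := hu
  exact ⟨A, fun s hs t ht => by rw [h hs, h ht]; exact hA s hs t ht⟩

/-- A function with a bounded derivative along the contour is Lipschitz, hence Hölder
continuous. -/
lemma isHolder_of_differentiableOn {α : ℝ} (hα : 0 < α) (hα1 : α ≤ 1) {u : ℂ → ℂ}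
    (hu : DifferentiableOn ℂ u L.carrier) (hb : ContinuousOn (derivWithin u L.carrier) L.carrier) :
    L.IsHolder α u := by
  obtain ⟨m, M, hm, hM, hmM⟩ := L.exists_deriv_bounds
  obtain ⟨c, hc, H⟩ := L.exists_chord_arc
  obtain ⟨B, hB0, hB⟩ := L.exists_bound hb
  refine ⟨B * M * (c⁻¹) ^ α, fun τ hτ t ht => ?_⟩
  obtain ⟨s, rfl⟩ := ht
  obtain ⟨σ, hσ, rfl⟩ := L.exists_shift_eq s hτ
  have h1 : ‖u (L.param (s + σ)) - u (L.param s)‖ ≤ B * M * |σ| := by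
    have := convex_univ.norm_image_sub_le_of_norm_hasDerivWithin_le (C := B * M)
      (f := fun s => u (L.param s)) (fun x _ => (hasDerivAt_comp_param
        (hu _ (L.param_mem_carrier x))).hasDerivWithinAt) (fun x _ => by
        rw [norm_mul]
        have h1 := hB x
        have h2 := (hmM x).2
        gcongr) (mem_univ s) (mem_univ (s + σ))
    simpa using this
  have h2 : |σ| ≤ |σ| ^ α := by
    conv_lhs => rw [← Real.rpow_one |σ|]
    exact Real.rpow_le_rpow_of_exponent_ge' (abs_nonneg _) (by linarith) hα.le hα1
  have h3 : |σ| ^ α ≤ (c⁻¹ * ‖L.param (s + σ) - L.param s‖) ^ α := by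
    gcongr
    rw [← div_eq_inv_mul, le_div_iff₀ hc, mul_comm]
    exact H s σ hσ
  rw [Real.mul_rpow (by positivity) (norm_nonneg _)] at h3
  calc ‖u (L.param (s + σ)) - u (L.param s)‖ ≤ B * M * |σ| := h1
    _ ≤ B * M * ((c⁻¹) ^ α * ‖L.param (s + σ) - L.param s‖ ^ α) := by
        gcongr; exact h2.trans h3
    _ = _ := by ring

lemma IsWH.contDiffOn {r : ℕ} {α : ℝ} {u : ℂ → ℂ} (hu : L.IsWH r α u) :
    ContDiffOn ℂ r u L.carrier :=
  contDiffOn_of_continuousOn_differentiableOn_deriv (n := (r : ℕ∞))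
    (fun m hm => hu.continuousOn m (by exact_mod_cast hm))
    (fun m hm => hu.differentiableOn m (by exact_mod_cast hm))

lemma isWH_of_contDiffOn {r : ℕ} {α : ℝ} {u : ℂ → ℂ} (hu : ContDiffOn ℂ r u L.carrier)
    (hr : L.IsHolder α (L.derivAlong r u)) : L.IsWH r α u := by
  have hc : ∀ k ≤ r, ContinuousOn (L.derivAlong k u) L.carrier := fun k hk =>
    hu.continuousOn_iteratedDerivWithin (by exact_mod_cast hk) uniqueDiffOn_carrier
  refine ⟨fun k hk => hu.differentiableOn_iteratedDerivWithin (by exact_mod_cast hk)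
    uniqueDiffOn_carrier, hc, ?_, hr⟩
  have hb : ∀ k ≤ r, ∃ M : ℝ, ∀ t ∈ L.carrier, ‖L.derivAlong k u t‖ ≤ M := fun k hk =>
    L.isCompact_carrier.exists_bound_of_continuousOn (hc k hk)
  choose! M hM using hb
  refine ⟨∑ k ∈ Finset.range (r + 1), |M k|, fun k hk t ht => ?_⟩
  refine (hM k hk t ht).trans ((le_abs_self _).trans ?_)
  exact Finset.single_le_sum (f := fun k => |M k|) (fun i _ => abs_nonneg _)
    (Finset.mem_range.2 (Nat.lt_succ_of_le hk))

/-- Below the top order the next derivative is bounded, so the derivative is Lipschitz and `α ≤ 1`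
gives the Hölder condition. -/
lemma IsWH.isHolder_derivAlong {r : ℕ} {α : ℝ} (hα : 0 < α) (hα1 : α ≤ 1) {u : ℂ → ℂ}
    (hu : L.IsWH r α u) {k : ℕ} (hk : k ≤ r) : L.IsHolder α (L.derivAlong k u) := by
  rcases hk.lt_or_eq with h | rfl
  · refine isHolder_of_differentiableOn hα hα1 (hu.differentiableOn k h) ?_
    rw [← derivAlong_succ]
    exact hu.continuousOn (k + 1) h
  · exact hu.holder

lemma IsWH.mono {r k : ℕ} {α : ℝ} (hα : 0 < α) (hα1 : α ≤ 1) {u : ℂ → ℂ}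
    (hu : L.IsWH r α u) (hk : k ≤ r) : L.IsWH k α u :=
  isWH_of_contDiffOn (hu.contDiffOn.of_le (by exact_mod_cast hk))
    (hu.isHolder_derivAlong hα hα1 hk)

lemma derivAlong_mul {r : ℕ} {u v : ℂ → ℂ} (hu : ContDiffOn ℂ r u L.carrier)
    (hv : ContDiffOn ℂ r v L.carrier) {t : ℂ} (ht : t ∈ L.carrier) :
    L.derivAlong r (fun τ => u τ * v τ) t = ∑ i ∈ Finset.range (r + 1),
      (r.choose i : ℂ) * L.derivAlong i u t * L.derivAlong (r - i) v t :=
  iteratedDerivWithin_mul ht uniqueDiffOn_carrier (hu t ht) (hv t ht)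

lemma IsWH.mul {r : ℕ} {α : ℝ} (hα : 0 < α) (hα1 : α ≤ 1) {u v : ℂ → ℂ}
    (hu : L.IsWH r α u) (hv : L.IsWH r α v) : L.IsWH r α (fun τ => u τ * v τ) := by
  refine isWH_of_contDiffOn (hu.contDiffOn.mul hv.contDiffOn) ?_
  refine IsHolder.congr (IsHolder.sum (Finset.range (r + 1)) fun i hi => ?_)
    (fun t ht => derivAlong_mul hu.contDiffOn hv.contDiffOn ht)
  exact ((IsHolder.const _).mul hα (hu.isHolder_derivAlong hα hα1
    (Nat.lt_succ_iff.1 (Finset.mem_range.1 hi)))).mul hα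
    (hv.isHolder_derivAlong hα hα1 (Nat.sub_le _ _))

lemma IsWH.sub {r : ℕ} {α : ℝ} {u v : ℂ → ℂ}
    (hu : L.IsWH r α u) (hv : L.IsWH r α v) : L.IsWH r α (fun τ => u τ - v τ) := by
  refine isWH_of_contDiffOn (hu.contDiffOn.sub hv.contDiffOn) ?_
  obtain ⟨A, hA⟩ := hu.holder
  obtain ⟨B, hB⟩ := hv.holder
  have e : ∀ t ∈ L.carrier, L.derivAlong r (fun τ => u τ - v τ) t =
      L.derivAlong r u t - L.derivAlong r v t := fun t ht =>
    iteratedDerivWithin_sub ht uniqueDiffOn_carrier (hu.contDiffOn t ht) (hv.contDiffOn t ht)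
  refine ⟨A + B, fun s hs t ht => ?_⟩
  rw [e s hs, e t ht, sub_sub_sub_comm, add_mul]
  exact (norm_sub_le _ _).trans (add_le_add (hA s hs t ht) (hB s hs t ht))

lemma isWH_of_analyticOnNhd {G : Set ℂ} (hG : L.carrier ⊆ G) {α : ℝ} (hα : 0 < α) (hα1 : α ≤ 1)
    (r : ℕ) {u : ℂ → ℂ} (hu : AnalyticOnNhd ℂ u G) : L.IsWH r α u := by
  have hc : ContDiffOn ℂ ((r + 1 : ℕ) : ℕ∞) u L.carrier := fun t ht =>
    (hu t (hG ht)).contDiffAt.contDiffWithinAt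
  refine isWH_of_contDiffOn (hc.of_le (by exact_mod_cast r.le_succ)) ?_
  refine isHolder_of_differentiableOn hα hα1 (hc.differentiableOn_iteratedDerivWithin
    (by exact_mod_cast r.lt_succ_self) uniqueDiffOn_carrier) ?_
  rw [← derivAlong_succ]
  exact hc.continuousOn_iteratedDerivWithin le_rfl uniqueDiffOn_carrier

lemma derivAlong_eq_iteratedDeriv {u : ℂ → ℂ} {t : ℂ} (ht : t ∈ L.carrier)
    (hu : AnalyticAt ℂ u t) (k : ℕ) : L.derivAlong k u t = iteratedDeriv k u t :=
  iteratedDerivWithin_eq_iteratedDeriv uniqueDiffOn_carrier hu.contDiffAt ht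

lemma IsWH.derivAlong_one {r : ℕ} {α : ℝ} {u : ℂ → ℂ} (hu : L.IsWH (r + 1) α u) :
    L.IsWH r α (L.derivAlong 1 u) := by
  refine isWH_of_contDiffOn ?_ ?_
  · rw [derivAlong, iteratedDerivWithin_one]
    exact hu.contDiffOn.derivWithin uniqueDiffOn_carrier (by exact_mod_cast le_rfl)
  · rw [← derivAlong_succ']
    exact hu.holder

lemma derivAlong_congr {u v : ℂ → ℂ} (h : EqOn u v L.carrier) (k : ℕ) :
    EqOn (L.derivAlong k u) (L.derivAlong k v) L.carrier := iteratedDerivWithin_congr h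

lemma IsWH.congr {r : ℕ} {α : ℝ} {u v : ℂ → ℂ} (hu : L.IsWH r α u) (h : EqOn v u L.carrier) :
    L.IsWH r α v :=
  isWH_of_contDiffOn (hu.contDiffOn.congr h) (IsHolder.congr hu.holder (derivAlong_congr h r))

/-! ### Boundary values of derivatives -/

lemma PositivelyOriented.closure_inner_eq (hL : L.PositivelyOriented) :
    closure L.inner = L.inner ∪ L.carrier := by
  refine Subset.antisymm ?_ (union_subset subset_closure hL.carrier_subset_closure_inner)
  rw [closure_eq_self_union_frontier]
  exact union_subset_union_right _ hL.frontier_inner_subset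

lemma IsAnalyticWH.isHolder {r : ℕ} {α : ℝ} (hα : 0 < α) (hα1 : α ≤ 1) {x : ℂ → ℂ}
    (hx : L.IsAnalyticWH r α x) : L.IsHolder α x := by
  have := hx.boundary.isHolder_derivAlong hα hα1 (Nat.zero_le r)
  rwa [derivAlong_zero] at this

lemma IsAnalyticWH.cauchyIntegral_inner {r : ℕ} {α : ℝ} (hα : 0 < α) (hα1 : α ≤ 1) {x : ℂ → ℂ}
    (hx : L.IsAnalyticWH r α x) (hL : L.PositivelyOriented) {z : ℂ} (hz : z ∈ L.inner) :
    L.cauchyIntegral x 1 z = 2 * Real.pi * Complex.I * x z := by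
  have := (hx.isHolder hα hα1).cauchyDefect_eq_zero hα hα1 hL hx.analytic.differentiableOn
    hx.continuousOn z
  rw [cauchyDefect_inner x hz] at this
  exact sub_eq_zero.1 this

lemma IsAnalyticWH.cauchyIntegral_outer {r : ℕ} {α : ℝ} (hα : 0 < α) (hα1 : α ≤ 1) {x : ℂ → ℂ}
    (hx : L.IsAnalyticWH r α x) (hL : L.PositivelyOriented) (n : ℕ) {z : ℂ} (hz : z ∈ L.outer) :
    L.cauchyIntegral x (n + 1) z = 0 := by
  induction n generalizing z with
  | zero =>
    have := (hx.isHolder hα hα1).cauchyDefect_eq_zero hα hα1 hL hx.analytic.differentiableOn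
      hx.continuousOn z
    rwa [cauchyDefect_outer x hz] at this
  -- Differentiating in `z` the identity that holds on the open outer domain raises the exponent by
  -- one.
  | succ n ih =>
    have h1 := L.hasDerivAt_cauchyIntegral ((hx.isHolder hα hα1).continuousOn hα) (n + 1) hz.1
    have h2 : HasDerivAt (L.cauchyIntegral x (n + 1)) 0 z := by
      refine (hasDerivAt_const z (0 : ℂ)).congr_of_eventuallyEq ?_
      filter_upwards [hL.isOpen_outer.mem_nhds hz] with y hy using ih hy
    have := h1.unique h2
    exact (mul_eq_zero.1 this).resolve_left (by exact_mod_cast n.succ_ne_zero)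

/-- Integration by parts on a closed curve: the difference of the integrands is the derivative of
`x(τ)/(τ - z)` along `L`. -/
lemma cauchyIntegral_two_eq {x : ℂ → ℂ} (hx : DifferentiableOn ℂ x L.carrier)
    (hx' : ContinuousOn (L.derivAlong 1 x) L.carrier) {z : ℂ} (hz : z ∉ L.carrier) :
    L.cauchyIntegral x 2 z = L.cauchyIntegral (L.derivAlong 1 x) 1 z := by
  have c1 := L.continuous_cauchy_integrand hx' 1 hz
  have c2 := L.continuous_cauchy_integrand hx.continuousOn 2 hz
  have h := L.contourIntegral_eq_zero_of_hasDerivAt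
    (g := fun τ => L.derivAlong 1 x τ / (τ - z) ^ 1 - x τ / (τ - z) ^ 2)
    (Q := fun τ => x τ * (τ - z)⁻¹) (by
      simp only [sub_mul]
      exact c1.sub c2) (fun s => by
      have h1 := hasDerivAt_comp_param (hx _ (L.param_mem_carrier s))
      have h2 := ((L.hasDerivAt_param s).sub_const z).fun_inv (L.param_sub_ne hz s)
      have hne := L.param_sub_ne hz s
      refine (h1.mul h2).congr_deriv ?_
      rw [derivAlong, iteratedDerivWithin_one]
      field_simp
      ring)
  rw [contourIntegral] at h
  simp only [sub_mul] at h
  rw [intervalIntegral.integral_sub (c1.intervalIntegrable _ _) (c2.intervalIntegrable _ _)] at h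
  exact (sub_eq_zero.1 h).symm

open Classical in
variable (L) in
/-- The function with values `y` inside the contour and `u` on it. -/
noncomputable def glue (y u : ℂ → ℂ) (z : ℂ) : ℂ := if z ∈ L.inner then y z else u z

lemma glue_inner (y u : ℂ → ℂ) {z : ℂ} (hz : z ∈ L.inner) : L.glue y u z = y z := if_pos hz

lemma glue_carrier (y u : ℂ → ℂ) {z : ℂ} (hz : z ∈ L.carrier) : L.glue y u z = u z :=
  if_neg fun h => h.1 hz

/-- Differentiating Cauchy's formula and integrating by parts, `2πi x'` in `D⁺` is the Cauchy
integral of the derivative along `L`. The same integral vanishes outside, so the outer Plemelj limit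
makes `differenceIntegral` zero, and the inner limit reduces to `2πi` times the derivative along
`L`. -/
lemma IsAnalyticWH.tendsto_deriv {r : ℕ} {α : ℝ} (hα : 0 < α) (hα1 : α ≤ 1) {x : ℂ → ℂ}
    (hx : L.IsAnalyticWH (r + 1) α x) (hL : L.PositivelyOriented) {t : ℂ} (ht : t ∈ L.carrier) :
    Tendsto (deriv x) (𝓝[L.inner] t) (𝓝 (L.derivAlong 1 x t)) := by
  have hH : L.IsHolder α (L.derivAlong 1 x) :=
    hx.boundary.isHolder_derivAlong hα hα1 (Nat.le_add_left 1 r)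
  have hd : DifferentiableOn ℂ x L.carrier := by
    simpa [derivAlong_zero] using hx.boundary.differentiableOn 0 r.succ_pos
  have hS : L.differenceIntegral (L.derivAlong 1 x) t = 0 := by
    have : (𝓝[L.outer] t).NeBot :=
      mem_closure_iff_nhdsWithin_neBot.1 (hL.carrier_subset_closure_outer ht)
    refine tendsto_nhds_unique (hH.tendsto_cauchyIntegral_outer hα hα1 hL ht) ?_
    refine tendsto_const_nhds.congr' ?_
    filter_upwards [self_mem_nhdsWithin] with z hz
    rw [← cauchyIntegral_two_eq hd (hH.continuousOn hα) hz.1,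
      hx.cauchyIntegral_outer hα hα1 hL 1 hz]
  have h := (hH.tendsto_cauchyIntegral_inner hα hα1 hL ht).const_mul (2 * Real.pi * Complex.I)⁻¹
  rw [hS, zero_add, inv_mul_cancel_left₀ Complex.two_pi_I_ne_zero] at h
  refine h.congr' ?_
  filter_upwards [self_mem_nhdsWithin] with z hz
  rw [← cauchyIntegral_two_eq hd (hH.continuousOn hα) hz.1]
  have h1 := (L.hasDerivAt_cauchyIntegral hd.continuousOn 1 hz.1).const_mul
    (2 * Real.pi * Complex.I)⁻¹
  have h2 : HasDerivAt x ((2 * Real.pi * Complex.I)⁻¹ *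
      ((1 : ℕ) * L.cauchyIntegral x (1 + 1) z)) z := by
    refine h1.congr_of_eventuallyEq ?_
    filter_upwards [hL.isOpen_inner.mem_nhds hz] with y hy
    rw [hx.cauchyIntegral_inner hα hα1 hL hy, inv_mul_cancel_left₀ Complex.two_pi_I_ne_zero]
  rw [h2.deriv, Nat.cast_one, one_mul]

/-- The derivative of a function of class `W^{r+1} H_α` is of class `W^r H_α`. -/
lemma IsAnalyticWH.glue_deriv {r : ℕ} {α : ℝ} (hα : 0 < α) (hα1 : α ≤ 1) {x : ℂ → ℂ}
    (hx : L.IsAnalyticWH (r + 1) α x) (hL : L.PositivelyOriented) :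
    L.IsAnalyticWH r α (L.glue (deriv x) (L.derivAlong 1 x)) := by
  have hin : ∀ z ∈ L.inner, L.glue (deriv x) (L.derivAlong 1 x) =ᶠ[𝓝 z] deriv x := fun z hz => by
    filter_upwards [hL.isOpen_inner.mem_nhds hz] with y hy using glue_inner _ _ hy
  have hcar : EqOn (L.glue (deriv x) (L.derivAlong 1 x)) (L.derivAlong 1 x) L.carrier :=
    fun t ht => glue_carrier _ _ ht
  refine ⟨fun z hz => ((hx.analytic z hz).deriv).congr (hin z hz).symm, ?_,
    hx.boundary.derivAlong_one.congr hcar⟩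
  intro z hz
  rw [hL.closure_inner_eq] at hz ⊢
  rcases hz with hz | hz
  · exact (((hx.analytic z hz).deriv).congr (hin z hz).symm).continuousAt.continuousWithinAt
  · rw [ContinuousWithinAt, nhdsWithin_union, hcar hz]
    refine Tendsto.sup ?_ ?_
    · refine (hx.tendsto_deriv hα hα1 hL hz).congr' ?_
      filter_upwards [self_mem_nhdsWithin] with y hy using (glue_inner _ _ hy).symm
    · refine ((hx.boundary.continuousOn 1 (Nat.le_add_left 1 r)) z hz).tendsto.congr' ?_
      filter_upwards [self_mem_nhdsWithin] with y hy using (hcar hy).symm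

/-- The derivatives inside the contour extend continuously by the derivatives along it. -/
theorem IsAnalyticWH.continuousOn_glue {r : ℕ} {α : ℝ} (hα : 0 < α) (hα1 : α ≤ 1) {x : ℂ → ℂ}
    (hx : L.IsAnalyticWH r α x) (hL : L.PositivelyOriented) {k : ℕ} (hk : k ≤ r) :
    ContinuousOn (L.glue (iteratedDeriv k x) (L.derivAlong k x)) (closure L.inner) := by
  induction k generalizing r x with
  | zero =>
    refine hx.continuousOn.congr fun z _ => ?_
    simp [glue, derivAlong_zero]
  | succ k ih =>
    obtain ⟨r, rfl⟩ : ∃ r', r = r' + 1 := ⟨r - 1, by omega⟩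
    refine (ih (hx.glue_deriv hα hα1 hL) (Nat.le_of_succ_le_succ hk)).congr fun z hz => ?_
    rw [hL.closure_inner_eq] at hz
    rcases hz with hz | hz
    · rw [glue_inner _ _ hz, glue_inner _ _ hz, iteratedDeriv_succ']
      refine Filter.EventuallyEq.iteratedDeriv_eq k ?_
      filter_upwards [hL.isOpen_inner.mem_nhds hz] with y hy using (glue_inner _ _ hy).symm
    · rw [glue_carrier _ _ hz, glue_carrier _ _ hz, derivAlong_succ']
      exact (derivAlong_congr (fun t ht => glue_carrier _ _ ht) k hz).symm

/-! ### Taylor expansion along the contour and the finite part integral. -/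

variable (L) in
/-- The Taylor polynomial of `u` along the contour at `t`. -/
noncomputable def taylorAlong (r : ℕ) (u : ℂ → ℂ) (t τ : ℂ) : ℂ :=
  ∑ k ∈ Finset.range (r + 1), L.derivAlong k u t / (k ! : ℂ) * (τ - t) ^ k

lemma taylorAlong_self (r : ℕ) (u : ℂ → ℂ) (t : ℂ) : L.taylorAlong r u t t = u t := by
  simp [taylorAlong, Finset.sum_range_succ', derivAlong_zero]

lemma hasDerivAt_taylorAlong (r : ℕ) (u : ℂ → ℂ) (t τ : ℂ) :
    HasDerivAt (L.taylorAlong (r + 1) u t) (L.taylorAlong r (L.derivAlong 1 u) t τ) τ := by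
  have h : HasDerivAt (fun τ => ∑ k ∈ Finset.range (r + 1),
      L.derivAlong (k + 1) u t / ((k + 1)! : ℂ) * (τ - t) ^ (k + 1))
      (∑ k ∈ Finset.range (r + 1), L.derivAlong (k + 1) u t / ((k + 1)! : ℂ) *
        (((k + 1 : ℕ) : ℂ) * (τ - t) ^ k * 1)) τ :=
    HasDerivAt.fun_sum fun k _ =>
      (((hasDerivAt_id τ).sub_const t).fun_pow (k + 1)).const_mul _
  have e : L.taylorAlong (r + 1) u t = fun τ => (∑ k ∈ Finset.range (r + 1),
      L.derivAlong (k + 1) u t / ((k + 1)! : ℂ) * (τ - t) ^ (k + 1)) +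
      L.derivAlong 0 u t / (0 ! : ℂ) * (τ - t) ^ 0 :=
    funext fun τ => Finset.sum_range_succ' _ _
  rw [e]
  simp only [pow_zero]
  refine (h.add_const _).congr_deriv (Finset.sum_congr rfl fun k _ => ?_)
  rw [← derivAlong_succ', Nat.factorial_succ]
  have h1 : ((k + 1 : ℕ) : ℂ) ≠ 0 := by exact_mod_cast k.succ_ne_zero
  have h2 : (k ! : ℂ) ≠ 0 := by exact_mod_cast k.factorial_ne_zero
  push_cast at h1 ⊢
  field_simp

lemma differentiable_taylorAlong (r : ℕ) (u : ℂ → ℂ) (t : ℂ) :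
    Differentiable ℂ (L.taylorAlong r u t) := by
  unfold taylorAlong
  fun_prop

/-- **Taylor's formula** along the contour, with a remainder bounded by a Hölder condition on the
last derivative. -/
lemma IsWH.exists_taylor_bound {r : ℕ} {α : ℝ} (hα : 0 < α) {u : ℂ → ℂ} (hu : L.IsWH r α u)
    (s : ℝ) : ∃ C > 0, ∀ σ : ℝ, |σ| ≤ 1 / 2 →
      ‖u (L.param (s + σ)) - L.taylorAlong r u (L.param s) (L.param (s + σ))‖ ≤
        C * |σ| ^ ((r : ℝ) + α) := by
  obtain ⟨m, M, hm, hM, hmM⟩ := L.exists_deriv_bounds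
  induction r generalizing u with
  | zero =>
    obtain ⟨K, hK, H⟩ := IsHolder.exists_pos (α := α) hu.holder
    refine ⟨K * M ^ α, by positivity, fun σ _ => ?_⟩
    have h1 := H _ (L.param_mem_carrier (s + σ)) _ (L.param_mem_carrier s)
    have h2 := L.norm_param_sub_le (fun s => (hmM s).2) (s + σ) s
    rw [add_sub_cancel_left] at h2
    simp only [derivAlong_zero] at h1
    simp only [taylorAlong, zero_add, Finset.range_one, Finset.sum_singleton, derivAlong_zero,
      Nat.factorial_zero, Nat.cast_one, div_one, pow_zero, mul_one, Nat.cast_zero]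
    calc _ ≤ K * ‖L.param (s + σ) - L.param s‖ ^ α := h1
      _ ≤ K * (M * |σ|) ^ α := by gcongr
      _ = _ := by rw [Real.mul_rpow hM.le (abs_nonneg _)]; ring
  | succ r ih =>
    -- The derivative of the remainder in the parameter is `γ'` times the remainder, of order one
    -- less, of the derivative along `L`; the mean value inequality then gains the factor `|σ|`.
    obtain ⟨C, hC, H⟩ := ih hu.derivAlong_one
    refine ⟨C * M, by positivity, fun σ hσ => ?_⟩
    have hd : ∀ x ∈ uIcc 0 σ, HasDerivWithinAt
        (fun x => u (L.param (s + x)) - L.taylorAlong (r + 1) u (L.param s) (L.param (s + x)))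
        ((L.derivAlong 1 u (L.param (s + x)) -
          L.taylorAlong r (L.derivAlong 1 u) (L.param s) (L.param (s + x))) *
            deriv L.param (s + x)) (uIcc 0 σ) x := fun x _ => by
      have hd0 := hu.differentiableOn 0 r.succ_pos
      rw [derivAlong_zero] at hd0
      have h1 := (hasDerivAt_comp_param (hd0 _ (L.param_mem_carrier (s + x)))).comp_const_add s x
      have h2 := ((hasDerivAt_taylorAlong (L := L) r u (L.param s) (L.param (s + x))).comp (s + x)
        (L.hasDerivAt_param (s + x))).comp_const_add s x
      refine ((h1.sub h2).congr_deriv ?_).hasDerivWithinAt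
      rw [derivAlong, iteratedDerivWithin_one]
      ring
    have := (convex_uIcc 0 σ).norm_image_sub_le_of_norm_hasDerivWithin_le hd
      (C := C * |σ| ^ ((r : ℝ) + α) * M) (fun x hx => by
        have hx' : |x| ≤ |σ| := by simpa using abs_sub_left_of_mem_uIcc hx
        rw [norm_mul]
        have h1 := H x (hx'.trans hσ)
        have h2 : C * |x| ^ ((r : ℝ) + α) ≤ C * |σ| ^ ((r : ℝ) + α) := by gcongr
        have h3 := h1.trans h2
        have h4 := (hmM (s + x)).2
        gcongr) left_mem_uIcc right_mem_uIcc
    simp only [add_zero, taylorAlong_self, sub_self, sub_zero, Real.norm_eq_abs] at this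
    refine this.trans (le_of_eq ?_)
    rcases eq_or_ne σ 0 with rfl | h0
    · have : ((r + 1 : ℕ) : ℝ) + α ≠ 0 := by positivity
      rw [abs_zero, mul_zero, Real.zero_rpow this, mul_zero]
    · have : ((r + 1 : ℕ) : ℝ) + α = (r + α) + 1 := by push_cast; ring
      rw [this, Real.rpow_add_one (abs_pos.2 h0).ne']
      ring

lemma inner_subset_of_closure {G : Set ℂ} (hG : closure L.inner ⊆ G) : L.inner ⊆ G :=
  subset_closure.trans hG

lemma isAnalyticWH_of_analyticOnNhd (hL : L.PositivelyOriented) {G : Set ℂ}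
    (hG : closure L.inner ⊆ G) {α : ℝ} (hα : 0 < α) (hα1 : α ≤ 1) (r : ℕ) {u : ℂ → ℂ}
    (hu : AnalyticOnNhd ℂ u G) : L.IsAnalyticWH r α u :=
  ⟨hu.mono (inner_subset_of_closure hG), hu.continuousOn.mono hG,
    isWH_of_analyticOnNhd (hL.carrier_subset_closure_inner.trans hG) hα hα1 r hu⟩

lemma IsAnalyticWH.mul {r : ℕ} {α : ℝ} (hα : 0 < α) (hα1 : α ≤ 1) {u v : ℂ → ℂ}
    (hu : L.IsAnalyticWH r α u) (hv : L.IsAnalyticWH r α v) :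
    L.IsAnalyticWH r α (fun τ => u τ * v τ) :=
  ⟨hu.analytic.mul hv.analytic, hu.continuousOn.mul hv.continuousOn,
    hu.boundary.mul hα hα1 hv.boundary⟩

lemma IsAnalyticWH.mono {r k : ℕ} {α : ℝ} (hα : 0 < α) (hα1 : α ≤ 1) {u : ℂ → ℂ}
    (hu : L.IsAnalyticWH r α u) (hk : k ≤ r) : L.IsAnalyticWH k α u :=
  ⟨hu.analytic, hu.continuousOn, hu.boundary.mono hα hα1 hk⟩

lemma IsAnalyticWH.sub {r : ℕ} {α : ℝ} {u v : ℂ → ℂ}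
    (hu : L.IsAnalyticWH r α u) (hv : L.IsAnalyticWH r α v) :
    L.IsAnalyticWH r α (fun τ => u τ - v τ) :=
  ⟨hu.analytic.sub hv.analytic, hu.continuousOn.sub hv.continuousOn,
    hu.boundary.sub hv.boundary⟩

section Remainder

variable {w : ℂ → ℂ} {r : ℕ} {α C : ℝ} {s : ℝ}

lemma measurable_remainder_kernel (hw : ContinuousOn w L.carrier) (n : ℕ) (s : ℝ) (z : ℂ) :
    Measurable fun σ : ℝ => w (L.param (s + σ)) / (L.param (s + σ) - z) ^ n *
      deriv L.param (s + σ) := by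
  have h1 : Measurable fun σ : ℝ => w (L.param (s + σ)) :=
    ((L.continuous_comp_param hw).comp (continuous_const_add s)).measurable
  exact (h1.div (((continuous_shift s).measurable.sub_const z).pow_const n)).mul
    (continuous_deriv_shift s).measurable

/-- A bound, uniform in `z`, for the kernel `w(τ) / (τ - z)^{r+1}` when `w` vanishes to order
`r + α` at a point of the contour that `z` approaches nontangentially. -/
lemma norm_remainder_kernel_le {c M : ℝ} (hc : 0 < c) (hM : 0 < M) (hC : 0 < C) {σ : ℝ}
    (hσ0 : σ ≠ 0) {b y d : ℂ} (hb : ‖b‖ ≤ C * |σ| ^ ((r : ℝ) + α)) (hy : c * |σ| ≤ ‖y‖)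
    (hd : ‖d‖ ≤ M) :
    ‖b / y ^ (r + 1) * d‖ ≤ C * M / c ^ (r + 1) * |σ| ^ (α - 1) := by
  have h0 : 0 < |σ| := abs_pos.2 hσ0
  rw [norm_mul, norm_div, norm_pow]
  calc ‖b‖ / ‖y‖ ^ (r + 1) * ‖d‖ ≤ C * |σ| ^ ((r : ℝ) + α) / (c * |σ|) ^ (r + 1) * M := by gcongr
    _ = C * M / c ^ (r + 1) * |σ| ^ (α - 1) := by
      have e : |σ| ^ ((r : ℝ) + α) = |σ| ^ (α - 1) * |σ| ^ (r + 1) := by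
        rw [← Real.rpow_natCast, ← Real.rpow_add h0]
        congr 1; push_cast; ring
      rw [e, mul_pow]
      field_simp

/-- The nontangential estimate bounds the kernels by a multiple of `|σ|^{α-1}`, uniformly in `ρ`.
The approach is along the outer normal, where Cauchy's theorem makes the integrals vanish when `w`
is analytic inside. -/
lemma tendsto_cauchyIntegral_remainder (hw : ContinuousOn w L.carrier) (hα : 0 < α)
    (hC : 0 < C) (hb : ∀ σ : ℝ, |σ| ≤ 1 / 2 → ‖w (L.param (s + σ))‖ ≤ C * |σ| ^ ((r : ℝ) + α)) :
    Tendsto (fun ρ => L.cauchyIntegral w (r + 1) (L.normalPoint s (-ρ))) (𝓝[>] 0)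
      (𝓝 (L.cauchyIntegral w (r + 1) (L.param s))) := by
  obtain ⟨m, M, hm, hM, hmM⟩ := L.exists_deriv_bounds
  obtain ⟨c, hc, ρ₀, hρ₀, H⟩ := L.exists_nontangential
  simp only [cauchyIntegral, L.contourIntegral_eq_shift _ s]
  refine intervalIntegral.tendsto_integral_filter_of_dominated_convergence
    (fun σ => C * M / c ^ (r + 1) * |σ| ^ (α - 1)) ?_ ?_
    ((intervalIntegrable_abs_rpow (by linarith) _ _).const_mul _) ?_
  · exact Eventually.of_forall fun ρ =>
      (measurable_remainder_kernel hw (r + 1) s _).aestronglyMeasurable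
  · filter_upwards [Ioc_mem_nhdsGT hρ₀] with ρ hρ
    filter_upwards [ae_ne_zero] with σ hσ0 hσ
    have hσ' := abs_le_half_of_mem_uIoc hσ
    refine norm_remainder_kernel_le hc hM hC hσ0 (hb σ hσ') ?_ (hmM _).2
    refine le_trans ?_ (H s σ (-ρ) hσ' (by rw [abs_neg, abs_of_pos hρ.1]; exact hρ.2))
    gcongr
    linarith [abs_nonneg (-ρ)]
  · filter_upwards [ae_ne_zero] with σ hσ0 hσ
    have hne := sub_ne_zero.2 (L.param_add_ne (s := s) hσ0 (abs_le_half_of_mem_uIoc hσ))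
    exact (tendsto_const_nhds.div (((tendsto_normalPoint_neg s).const_sub _).pow _)
      (pow_ne_zero _ hne)).mul_const _

/-- The kernel is absolutely integrable, so truncation is harmless and the limit is the ordinary
integral, the same as the one reached along the outer normal. -/
lemma tendsto_truncatedIntegral_remainder (hw : ContinuousOn w L.carrier) (hα : 0 < α)
    (hC : 0 < C) (hb : ∀ σ : ℝ, |σ| ≤ 1 / 2 → ‖w (L.param (s + σ))‖ ≤ C * |σ| ^ ((r : ℝ) + α)) :
    Tendsto (L.truncatedIntegral (fun τ => w τ / (τ - L.param s) ^ (r + 1)) (L.param s)) (𝓝[>] 0)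
      (𝓝 (L.cauchyIntegral w (r + 1) (L.param s))) := by
  obtain ⟨m, M, hm, hM, hmM⟩ := L.exists_deriv_bounds
  obtain ⟨c, hc, H⟩ := L.exists_chord_arc
  have e : L.truncatedIntegral (fun τ => w τ / (τ - L.param s) ^ (r + 1)) (L.param s) = fun v =>
      ∫ σ in (-(1 / 2) : ℝ)..(1 / 2), if v < ‖L.param (s + σ) - L.param s‖ then
        w (L.param (s + σ)) / (L.param (s + σ) - L.param s) ^ (r + 1) * deriv L.param (s + σ)
        else 0 := by
    ext v
    rw [truncatedIntegral_eq, L.contourIntegral_eq_shift _ s]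
    simp only [ite_mul, zero_mul]
  rw [e, cauchyIntegral, L.contourIntegral_eq_shift _ s]
  refine intervalIntegral.tendsto_integral_filter_of_dominated_convergence
    (fun σ => C * M / c ^ (r + 1) * |σ| ^ (α - 1)) ?_ ?_
    ((intervalIntegrable_abs_rpow (by linarith) _ _).const_mul _) ?_
  · refine Eventually.of_forall fun v => (Measurable.ite ?_
      (measurable_remainder_kernel hw (r + 1) s _) measurable_const).aestronglyMeasurable
    exact (isOpen_lt continuous_const ((continuous_shift s).sub continuous_const).norm).measurableSet
  · refine Eventually.of_forall fun v => ?_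
    filter_upwards [ae_ne_zero] with σ hσ0 hσ
    have hσ' := abs_le_half_of_mem_uIoc hσ
    split_ifs
    · exact norm_remainder_kernel_le hc hM hC hσ0 (hb σ hσ') (H s σ hσ') (hmM _).2
    · rw [norm_zero]; positivity
  · filter_upwards [ae_ne_zero] with σ hσ0 hσ
    have hpos := norm_pos_iff.2
      (sub_ne_zero.2 (L.param_add_ne (s := s) hσ0 (abs_le_half_of_mem_uIoc hσ)))
    refine tendsto_const_nhds.congr' ?_
    filter_upwards [Ioo_mem_nhdsGT hpos] with v hv
    rw [if_pos hv.2]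

end Remainder

lemma truncatedIntegral_eq_add_sum {u w : ℂ → ℂ} (hw : ContinuousOn w L.carrier) (r : ℕ)
    (k : ℕ → ℂ) (t : ℂ) (hu : ∀ τ, u τ = w τ + ∑ i ∈ Finset.range (r + 1), k i * (τ - t) ^ i)
    {v : ℝ} (hv : 0 < v) :
    L.truncatedIntegral (fun τ => u τ / (τ - t) ^ (r + 1)) t v =
      L.truncatedIntegral (fun τ => w τ / (τ - t) ^ (r + 1)) t v +
        ∑ i ∈ Finset.range (r + 1), k i *
          L.truncatedIntegral (fun τ => 1 / (τ - t) ^ (r + 1 - i)) t v := by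
  have i1 := intervalIntegrable_truncated (L := L) hw (r + 1) t hv 0 1
  have i2 := fun n => intervalIntegrable_truncated (L := L) (u := fun _ => 1) continuousOn_const
    n t hv 0 1
  have i3 : IntervalIntegrable (fun s => ∑ i ∈ Finset.range (r + 1), k i *
      ((if v < ‖L.param s - t‖ then 1 / (L.param s - t) ^ (r + 1 - i) else 0) * deriv L.param s))
      volume 0 1 := by
    have := IntervalIntegrable.sum (Finset.range (r + 1))
      fun i _ => (i2 (r + 1 - i)).const_mul (k i)
    simpa only [Finset.sum_fn] using this
  simp only [truncatedIntegral_eq, contourIntegral]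
  simp only [← intervalIntegral.integral_const_mul]
  rw [← intervalIntegral.integral_finsetSum fun i _ => (i2 (r + 1 - i)).const_mul (k i),
    ← intervalIntegral.integral_add i1 i3]
  refine intervalIntegral.integral_congr fun s _ => ?_
  by_cases h : v < ‖L.param s - t‖
  · have hne : L.param s - t ≠ 0 := norm_pos_iff.1 (hv.trans h)
    simp only [h, if_true]
    rw [hu, add_div, add_mul, Finset.sum_div, Finset.sum_mul]
    congr 1
    refine Finset.sum_congr rfl fun i hi => ?_
    have hi' : i ≤ r + 1 := (Finset.mem_range.1 hi).le
    rw [← mul_assoc, pow_sub₀ _ hne hi']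
    field_simp
  · simp [h]

/-- The value of the hypersingular integral of a function that is holomorphic inside the contour. -/
theorem IsAnalyticWH.hasFinitePartIntegral {r : ℕ} {α : ℝ} (hα : 0 < α) (hα1 : α ≤ 1) {u : ℂ → ℂ}
    (hu : L.IsAnalyticWH r α u) (hL : L.PositivelyOriented) {t : ℂ} (ht : t ∈ L.carrier) :
    L.HasFinitePartIntegral (r + 1) u t
      (L.derivAlong r u t / (r ! : ℂ) * (Real.pi * Complex.I)) := by
  have ht' := ht
  obtain ⟨s, rfl⟩ := ht
  set t := L.param s
  have hw : L.IsAnalyticWH 0 α (fun τ => u τ - L.taylorAlong r u t τ) :=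
    (hu.mono hα hα1 (Nat.zero_le r)).sub (isAnalyticWH_of_analyticOnNhd hL (subset_univ _) hα hα1 0
      fun z _ => (differentiable_taylorAlong r u t).analyticAt z)
  have hwc := (hw.isHolder hα hα1).continuousOn hα
  obtain ⟨C, hC, hb⟩ := hu.boundary.exists_taylor_bound hα s
  -- The remainder is again analytic inside, as the Taylor polynomial is entire; its Cauchy
  -- integrals at outer points are zero and converge to the one at `t`.
  have hzero : L.cauchyIntegral (fun τ => u τ - L.taylorAlong r u t τ) (r + 1) t = 0 := by
    refine tendsto_nhds_unique (tendsto_cauchyIntegral_remainder hwc hα hC hb) ?_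
    refine tendsto_const_nhds.congr' ?_
    filter_upwards [hL.eventually_normalPoint_mem s] with ρ hρ
    exact (hw.cauchyIntegral_outer hα hα1 hL r hρ.2).symm
  have h1 := tendsto_truncatedIntegral_remainder hwc hα hC hb
  rw [hzero] at h1
  have h2 := h1.add ((hL.tendsto_truncatedIntegral_inv ht').const_mul
    (L.derivAlong r u t / (r ! : ℂ)))
  rw [zero_add] at h2
  refine h2.congr' ?_
  filter_upwards [self_mem_nhdsWithin] with v hv
  -- Before any limit is taken, the terms of degree below `r` cancel the divergent part exactly;
  -- degree `r` leaves the exponent `r + 1 - r = 1`.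
  rw [truncatedIntegral_eq_add_sum (u := u) hwc r (fun k => L.derivAlong k u t / (k ! : ℂ)) t
    (fun τ => by simp [taylorAlong]) hv, divergentPart, Nat.add_sub_cancel,
    Finset.sum_range_succ, Nat.add_sub_cancel_left]
  ring

end SmoothClosedContour

/-! ### The kernel `h` and the equivalence of the two equations. -/

/-- Each derivative in `τ` is the Fréchet derivative of the previous one in the direction `(0, 1)`.
Joint analyticity is kept so that the restriction to the diagonal, a coefficient of (2), is
analytic. -/
lemma analyticOnNhd_iteratedDeriv_snd {G : Set ℂ} (hG : IsOpen G) {h : ℂ → ℂ → ℂ}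
    (hh : AnalyticOnNhd ℂ (fun q : ℂ × ℂ => h q.1 q.2) (G ×ˢ G)) (i : ℕ) :
    AnalyticOnNhd ℂ (fun q : ℂ × ℂ => iteratedDeriv i (h q.1) q.2) (G ×ˢ G) := by
  induction i with
  | zero => simpa using hh
  | succ i ih =>
    have h1 : AnalyticOnNhd ℂ (fun q : ℂ × ℂ =>
        fderiv ℂ (fun q : ℂ × ℂ => iteratedDeriv i (h q.1) q.2) q (0, 1)) (G ×ˢ G) := fun q hq =>
      (ContinuousLinearMap.apply ℂ ℂ ((0, 1) : ℂ × ℂ)).analyticAt _ |>.comp (ih.fderiv q hq)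
    refine h1.congr (hG.prod hG) fun q hq => ?_
    have h2 := (ih q hq).differentiableAt.hasFDerivAt
    have h3 : HasDerivAt (fun τ : ℂ => (q.1, τ)) ((0 : ℂ), (1 : ℂ)) q.2 :=
      (hasDerivAt_const q.2 q.1).prodMk (hasDerivAt_id q.2)
    have h4 := HasFDerivAt.comp_hasDerivAt (f := fun τ : ℂ => (q.1, τ)) q.2 h2 h3
    rw [iteratedDeriv_succ]
    exact h4.deriv.symm

lemma analyticOnNhd_iteratedDeriv_diag {G : Set ℂ} (hG : IsOpen G) {h : ℂ → ℂ → ℂ}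
    (hh : AnalyticOnNhd ℂ (fun q : ℂ × ℂ => h q.1 q.2) (G ×ˢ G)) (i : ℕ) :
    AnalyticOnNhd ℂ (fun z => iteratedDeriv i (h z) z) G := fun z hz =>
  (analyticOnNhd_iteratedDeriv_snd hG hh i (z, z) ⟨hz, hz⟩).comp₂ analyticAt_id analyticAt_id

lemma analyticOnNhd_of_uncurry {G : Set ℂ} {h : ℂ → ℂ → ℂ}
    (hh : AnalyticOnNhd ℂ (fun q : ℂ × ℂ => h q.1 q.2) (G ×ˢ G)) {t : ℂ} (ht : t ∈ G) :
    AnalyticOnNhd ℂ (h t) G := fun τ hτ =>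
  (hh (t, τ) ⟨ht, hτ⟩).comp₂ analyticAt_const analyticAt_id

namespace SmoothClosedContour

variable {L : SmoothClosedContour}

/-- The hypersingular integral of `h(t, ·) x`, in terms of the derivatives of `x` along the
contour. -/
theorem IsAnalyticWH.hasFinitePartIntegral_kernel (hL : L.PositivelyOriented) {G : Set ℂ}
    (hLG : closure L.inner ⊆ G) {α : ℝ} (hα : 0 < α) (hα1 : α ≤ 1) {h : ℂ → ℂ → ℂ}
    (hh : AnalyticOnNhd ℂ (fun q : ℂ × ℂ => h q.1 q.2) (G ×ˢ G)) {r : ℕ} {x : ℂ → ℂ}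
    (hx : L.IsAnalyticWH r α x) {t : ℂ} (ht : t ∈ L.carrier) :
    L.HasFinitePartIntegral (r + 1) (fun τ => h t τ * x τ) t
      ((∑ i ∈ Finset.range (r + 1), (r.choose i : ℂ) * iteratedDeriv i (h t) t *
        L.derivAlong (r - i) x t) / (r ! : ℂ) * (Real.pi * Complex.I)) := by
  have htG : t ∈ G := hLG (hL.carrier_subset_closure_inner ht)
  have hht := analyticOnNhd_of_uncurry hh htG
  have hhW := isAnalyticWH_of_analyticOnNhd hL hLG hα hα1 r hht
  have := (hhW.mul hα hα1 hx).hasFinitePartIntegral hα hα1 hL ht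
  rw [derivAlong_mul hhW.boundary.contDiffOn hx.boundary.contDiffOn ht] at this
  simpa only [derivAlong_eq_iteratedDeriv ht (hht t htG)] using this

end SmoothClosedContour

theorem mainTheorem2 (L : SmoothClosedContour) (hL : L.PositivelyOriented)
    (G : Set ℂ) (hG : IsOpen G) (hLG : closure L.inner ⊆ G)
    (p : ℕ) (hp : 2 ≤ p) (α : ℝ) (hα : 0 < α) (hα1 : α ≤ 1)
    (h : ℂ → ℂ → ℂ) (hh : AnalyticOnNhd ℂ (fun q : ℂ × ℂ => h q.1 q.2) (G ×ˢ G))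
    (a f : ℂ → ℂ) (ha : AnalyticOnNhd ℂ a G) (hf : AnalyticOnNhd ℂ f G) :
    -- the singular integral identity
    (∀ x : ℂ → ℂ, L.IsAnalyticWH 0 α x → ∀ t ∈ L.carrier, ∃ I : ℂ,
      L.HasFinitePartIntegral 1 (fun τ => h t τ * x τ) t I ∧
        1 / (Real.pi * Complex.I) * I = h t t * x t) ∧
    -- solutions of the integral equation solve the differential equation, on `L` and in `D⁺`
    (∀ x : ℂ → ℂ, L.IsAnalyticWH (p - 1) α x → L.SolvesIntegralEq p h a f x →
      (∀ t ∈ L.carrier, SatisfiesODEAt p h a f (fun k => L.derivAlong k x t) t) ∧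
      (∀ z ∈ L.inner, SatisfiesODEAt p h a f (fun k => iteratedDeriv k x z) z)) ∧
    -- solutions of the differential equation analytic in `G` solve the integral equation
    (∀ x : ℂ → ℂ, AnalyticOnNhd ℂ x G →
      (∀ t ∈ L.carrier, SatisfiesODEAt p h a f (fun k => iteratedDeriv k x t) t) →
      L.SolvesIntegralEq p h a f x) := by
  have hpi : (Real.pi : ℂ) * Complex.I ≠ 0 :=
    mul_ne_zero (Complex.ofReal_ne_zero.2 Real.pi_ne_zero) Complex.I_ne_zero
  obtain ⟨r, rfl⟩ : ∃ r, p = r + 1 := ⟨p - 1, by omega⟩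
  rw [Nat.add_sub_cancel]
  have hcar : L.carrier ⊆ G := hL.carrier_subset_closure_inner.trans hLG
  refine ⟨fun x hx t ht => ?_, fun x hx hsol => ?_, fun x hx hode t ht => ?_⟩
  · refine ⟨_, hx.hasFinitePartIntegral_kernel hL hLG hα hα1 hh ht, ?_⟩
    simp only [zero_add, Finset.range_one, Finset.sum_singleton, Nat.choose_self, Nat.cast_one,
      one_mul, iteratedDeriv_zero, Nat.sub_self, SmoothClosedContour.derivAlong_zero,
      Nat.factorial_zero, div_one]
    field_simp
  · have hcarrier : ∀ t ∈ L.carrier,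
        SatisfiesODEAt (r + 1) h a f (fun k => L.derivAlong k x t) t := by
      intro t ht
      obtain ⟨I, hI, heq⟩ := hsol t ht
      -- The finite part is a limit, hence unique, so the integral given by the equation is the
      -- computed one.
      rw [tendsto_nhds_unique hI (hx.hasFinitePartIntegral_kernel hL hLG hα hα1 hh ht)] at heq
      rw [SatisfiesODEAt, ← heq, Nat.add_sub_cancel, SmoothClosedContour.derivAlong_zero]
      field_simp
      ring
    refine ⟨hcarrier, ?_⟩
    -- Ordinary derivatives of `x` at points of `L` carry no information, so they are replaced there
    -- by the derivatives along `L`; `F` is then the left side of (2) on the whole closure.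
    let X : ℕ → ℂ → ℂ := fun k => L.glue (iteratedDeriv k x) (L.derivAlong k x)
    let F : ℂ → ℂ := fun z => 1 / (r ! : ℂ) * (∑ i ∈ Finset.range (r + 1),
      (r.choose i : ℂ) * iteratedDeriv i (h z) z * X (r - i) z) + a z * X 0 z
    have hXc : ∀ k ≤ r, ContinuousOn (X k) (closure L.inner) := fun k hk =>
      hx.continuousOn_glue hα hα1 hL hk
    have hXd : ∀ k, DifferentiableOn ℂ (X k) L.inner := fun k z hz => by
      have h1 : DifferentiableAt ℂ (iteratedDeriv k x) z := by
        rw [iteratedDeriv_eq_iterate]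
        exact (AnalyticAt.iterated_deriv (hx.analytic z hz) k).differentiableAt
      exact (h1.differentiableWithinAt).congr (fun y hy => SmoothClosedContour.glue_inner _ _ hy)
        (SmoothClosedContour.glue_inner _ _ hz)
    have hH := fun i => analyticOnNhd_iteratedDeriv_diag hG hh i
    have hin := SmoothClosedContour.inner_subset_of_closure hLG
    have hFd : DiffContOnCl ℂ F L.inner := by
      refine ⟨?_, ?_⟩
      · refine (DifferentiableOn.const_mul (DifferentiableOn.fun_sum fun i _ => ?_) _).add
          ((ha.differentiableOn.mono hin).mul (hXd 0))
        exact (((hH i).differentiableOn.mono hin).const_mul _).mul (hXd _)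
      · refine (continuousOn_const.mul (continuousOn_finsetSum _ fun i _ => ?_)).add
          ((ha.continuousOn.mono hLG).mul (hXc 0 (Nat.zero_le r)))
        exact (continuousOn_const.mul ((hH i).continuousOn.mono hLG)).mul
          (hXc _ (Nat.sub_le _ _))
    have hFf : EqOn F f L.inner := by
      -- Maximum principle on the bounded set `D⁺`, whose frontier lies in `L`, where (2) is already
      -- known.
      refine Complex.eqOn_of_eqOn_frontier hL.isBounded_inner hFd
        ⟨hf.differentiableOn.mono hin, hf.continuousOn.mono hLG⟩ fun t ht => ?_
      have htc := hL.frontier_inner_subset ht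
      have := hcarrier t htc
      rw [SatisfiesODEAt, Nat.add_sub_cancel] at this
      simpa only [F, X, SmoothClosedContour.glue_carrier _ _ htc] using this
    intro z hz
    have := hFf hz
    rw [SatisfiesODEAt, Nat.add_sub_cancel]
    simpa only [F, X, SmoothClosedContour.glue_inner _ _ hz] using this
  · have hxW := SmoothClosedContour.isAnalyticWH_of_analyticOnNhd hL hLG hα hα1 r hx
    refine ⟨_, hxW.hasFinitePartIntegral_kernel hL hLG hα hα1 hh ht, ?_⟩
    have := hode t ht
    rw [SatisfiesODEAt, Nat.add_sub_cancel, iteratedDeriv_zero] at this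
    rw [← this]
    simp only [SmoothClosedContour.derivAlong_eq_iteratedDeriv ht (hx t (hcar ht))]
    field_simp
    ring
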